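/- Let $n\ge 2$, $\sigma>0$, $\theta_0\in\mathbb R^n$, and consider the linear regression model $y(t)=\phi(t)^T\theta_0+v(t)$, $t=1,2,\dots$, where $v(1),v(2),\dots$ are independent $\mathcal N(0,\sigma^2)$ random variables and the regressors $\phi(t)\in\mathbb R^n$ are random vectors (possibly deterministic) such that the sequence $(\phi(t))_t$ is independent of the sequence $(v(t))_t$. For sample size $N$ let $\Phi\in\mathbb R^{N\times n}$ have rows $\phi(1)^T,\dots,\phi(N)^T$ and let $Y=(y(1),\dots,y(N))^T$. Suppose that, as $N\to\infty$, $\Phi^T\Phi/N\to\Sigma$ almost surely, with $\Sigma$ positive definite. Let $P=P(\eta)=\eta I_n$ (ridge regression) with $\eta$ in an open set $\Omega\subset(0,\infty)$, and put $Q=\Phi P\Phi^T+\sigma^2 I_N$ and $\hat\theta^{R}=P\Phi^TQ^{-1}Y$. Let $\hat\eta_{EB}$ and $\hat\eta_{Sy}$ be random variables (depending on $N$) which, with probability tending to $1$ as $N\to\infty$, are minimizers over $\Omega$ of, respectively, $$\mathcal F_{EB}(\eta)=Y^TQ^{-1}Y+\log\det Q,\qquad \mathcal F_{Sy}(\eta)=\|Y-\Phi\hat\theta^{R}\|_2^2+2\sigma^2\operatorname{Tr}(\Phi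 P\Phi^TQ^{-1}).$$ Let $\eta_b^*\in\Omega$ and $\eta_y^*\in\Omega$ be minimizers over $\Omega$ of, respectively, $$W_b(\eta)=\theta_0^TP^{-1}\theta_0+\log\det P,\qquad W_y(\eta)=\sigma^4\theta_0^TP^{-T}\Sigma^{-1}P^{-1}\theta_0-2\sigma^4\operatorname{Tr}(\Sigma^{-1}P^{-1}).$$ 1. As $N\to\infty$, $$\sqrt N(\hat\eta_{EB}-\eta_b^*)\overset{d}{\to}\mathcal N\Big(0,\frac{4\sigma^2}{n^2}\theta_0^T\Sigma^{-1}\theta_0\Big).$$ 2. Suppose moreover that $\|\Phi^T\Phi/N-\Sigma\|_F=O_p(\delta_N)$ for a sequence $\delta_N>0$ with $\delta_N=o(1/\sqrt N)$, where $\xi_N=O_p(\delta_N)$ means that for every $\epsilon>0$ there is $L>0$ with $\Pr(|\xi_N/\delta_N|>L)<\epsilon$ for all $N\geq 1$. Then, as $N\to\infty$, $$\sqrt N(\hat\eta_{Sy}-\eta_y^*)\overset{d}{\to}\mathcal N\Big(0,\frac{4\sigma^2}{\operatorname{Tr}(\Sigma^{-1})^2}\theta_0^T\Sigma^{-3}\theta_0\Big).$$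 3. Write $\lambda_1(\cdot)\ge\dots\ge\lambda_n(\cdot)$ for the eigenvalues of a symmetric matrix. Let the positive definite matrix $\Sigma$ vary along a sequence such that $\lambda_n(\Sigma)\to0$ while $\lambda_1(\Sigma),\dots,\lambda_{n-1}(\Sigma)$ are fixed, and suppose that there are unit eigenvectors $u_n$ of $\Sigma$ for $\lambda_n(\Sigma)$ with $|u_n^T\theta_0|$ bounded away from $0$ along the sequence (for fixed eigenvectors: $u_n^T\theta_0\neq0$). Then $\lambda_1(\Sigma)/\lambda_n(\Sigma)\to\infty$, and the ratio of the asymptotic variance in 1 to that in 2 satisfies $$\frac{\theta_0^T\Sigma^{-1}\theta_0/n^2}{\theta_0^T\Sigma^{-3}\theta_0/\operatorname{Tr}(\Sigma^{-1})^2}\to\frac1{n^2}.$$ -/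

import Mathlib

open Filter Topology MeasureTheory ProbabilityTheory Matrix
open scoped ENNReal NNReal

noncomputable section

namespace RidgeAsymptotics

/-- Regression matrix of sample size `N`: its rows are the first `N` regressors. -/
def regMatrix {n : ℕ} (φ : ℕ → Fin n → ℝ) (N : ℕ) : Matrix (Fin N) (Fin n) ℝ :=
  Matrix.of fun t => φ t

/-- Output vector `Y = Φ θ₀ + V` of the linear regression model at sample size `N`. -/
def outputVec {n : ℕ} (φ : ℕ → Fin n → ℝ) (v : ℕ → ℝ) (θ₀ : Fin n → ℝ) (N : ℕ) : Fin N → ℝ :=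
  regMatrix φ N *ᵥ θ₀ + fun t : Fin N => v t

/-- `Q = Φ P Φᵀ + σ² I_N`. -/
def qMatrix {n N : ℕ} (σ : ℝ) (Φ : Matrix (Fin N) (Fin n) ℝ) (P : Matrix (Fin n) (Fin n) ℝ) :
    Matrix (Fin N) (Fin N) ℝ :=
  Φ * P * Φᵀ + σ ^ 2 • (1 : Matrix (Fin N) (Fin N) ℝ)

/-- Regularized least squares estimator `P Φᵀ Q⁻¹ Y`. -/
def rlsEstimator {n N : ℕ} (σ : ℝ) (Φ : Matrix (Fin N) (Fin n) ℝ) (Y : Fin N → ℝ)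
    (P : Matrix (Fin n) (Fin n) ℝ) : Fin n → ℝ :=
  (P * Φᵀ * (qMatrix σ Φ P)⁻¹) *ᵥ Y

/-- Empirical Bayes cost `Yᵀ Q⁻¹ Y + log det Q`. -/
def costEB {n N : ℕ} (σ : ℝ) (Φ : Matrix (Fin N) (Fin n) ℝ) (Y : Fin N → ℝ)
    (P : Matrix (Fin n) (Fin n) ℝ) : ℝ :=
  Y ⬝ᵥ ((qMatrix σ Φ P)⁻¹ *ᵥ Y) + Real.log (qMatrix σ Φ P).det

/-- `SURE_y` cost `‖Y - Φ θ̂‖² + 2 σ² Tr(Φ P Φᵀ Q⁻¹)`, with `θ̂` the regularized least squares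
estimator and `‖·‖` the Euclidean norm. -/
def costSy {n N : ℕ} (σ : ℝ) (Φ : Matrix (Fin N) (Fin n) ℝ) (Y : Fin N → ℝ)
    (P : Matrix (Fin n) (Fin n) ℝ) : ℝ :=
  (Y - Φ *ᵥ rlsEstimator σ Φ Y P) ⬝ᵥ (Y - Φ *ᵥ rlsEstimator σ Φ Y P)
    + 2 * σ ^ 2 * (Φ * P * Φᵀ * (qMatrix σ Φ P)⁻¹).trace

/-- Limit of the (normalized) empirical Bayes cost: `θ₀ᵀ P⁻¹ θ₀ + log det P`. -/
def limitEB {n : ℕ} (θ₀ : Fin n → ℝ) (P : Matrix (Fin n) (Fin n) ℝ) : ℝ :=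
  θ₀ ⬝ᵥ (P⁻¹ *ᵥ θ₀) + Real.log P.det

/-- Limit of the (normalized) `SURE_y` cost: `σ⁴ θ₀ᵀ P⁻ᵀ Σ⁻¹ P⁻¹ θ₀ - 2 σ⁴ Tr(Σ⁻¹ P⁻¹)`. -/
def limitSy {n : ℕ} (σ : ℝ) (Sig : Matrix (Fin n) (Fin n) ℝ) (θ₀ : Fin n → ℝ)
    (P : Matrix (Fin n) (Fin n) ℝ) : ℝ :=
  σ ^ 4 * (θ₀ ⬝ᵥ ((P⁻¹ᵀ * Sig⁻¹ * P⁻¹) *ᵥ θ₀)) - 2 * σ ^ 4 * (Sig⁻¹ * P⁻¹).trace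

/-- Ridge kernel `P(η) = η I_n`. -/
def ridgeKernel (n : ℕ) (η : ℝ) : Matrix (Fin n) (Fin n) ℝ := η • 1

/-- `x` is a minimizer of `f` over `H`. -/
def IsArgmin (f : ℝ → ℝ) (H : Set ℝ) (x : ℝ) : Prop := x ∈ H ∧ IsMinOn f H x

/-- Frobenius norm. -/
def frobNorm {n : ℕ} (A : Matrix (Fin n) (Fin n) ℝ) : ℝ := Real.sqrt (∑ i, ∑ j, A i j ^ 2)

/-- `ξ_N = O_p(a_N)`, for a sequence of positive reals `a_N`, `N ≥ 1`. -/
def IsBigOInProb {Ω : Type*} [MeasurableSpace Ω] (μ : Measure Ω) (ξ : ℕ → Ω → ℝ) (a : ℕ → ℝ) :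
    Prop :=
  ∀ ε : ℝ, 0 < ε → ∃ L : ℝ, 0 < L ∧ ∀ N : ℕ, 1 ≤ N →
    μ {ω | L < |ξ N ω / a N|} < ENNReal.ofReal ε

/-- Asymptotic variance `4 σ² θ₀ᵀ Σ⁻¹ θ₀ / n²`. -/
def asympVarEB {n : ℕ} (σ : ℝ) (Sig : Matrix (Fin n) (Fin n) ℝ) (θ₀ : Fin n → ℝ) : ℝ :=
  4 * σ ^ 2 / (n : ℝ) ^ 2 * (θ₀ ⬝ᵥ (Sig⁻¹ *ᵥ θ₀))

/-- Asymptotic variance `4 σ² θ₀ᵀ Σ⁻³ θ₀ / Tr(Σ⁻¹)²`. -/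
def asympVarSy {n : ℕ} (σ : ℝ) (Sig : Matrix (Fin n) (Fin n) ℝ) (θ₀ : Fin n → ℝ) : ℝ :=
  4 * σ ^ 2 / (Sig⁻¹.trace) ^ 2 * (θ₀ ⬝ᵥ ((Sig⁻¹ ^ 3) *ᵥ θ₀))

/-- Eigenvalues `λ_1 ≥ ⋯ ≥ λ_n` of a real symmetric matrix in decreasing order, with
multiplicity; the index `i : Fin n` stands for `λ_{i+1}`. -/
def sortedEig {n : ℕ} {A : Matrix (Fin n) (Fin n) ℝ} (hA : A.IsHermitian) (i : Fin n) : ℝ :=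
  hA.eigenvalues₀ (Fin.cast (Fintype.card_fin n).symm i)

end RidgeAsymptotics

end

/-!
In an eigenbasis of `ΦΦᵀ` both costs are sums of elementary functions of `η`, so a positive local
minimizer satisfies a first order condition. The push-through identity moves that condition to the
parameter space, where it is an `O(1/N)` perturbation of `η Tr J = θ̂ᵀJθ̂` with `θ̂` the least
squares estimate and `J = (ΦᵀΦ/N)⁻ᵏ`; here `k = 0` for empirical Bayes and `k = 1` for `SURE_y`.
The fluctuations of the estimators are therefore those of `θ̂ᵀJθ̂ / Tr J`. Conditionally on the
regressors `√N (θ̂ - θ₀)` is Gaussian, and the delta method gives the limit law; for `k = 1` the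
rate `δ_N = o(1/√N)` makes `√N (J - Σ⁻¹)` negligible.

For the ratio of the variances put `R = λ_n Σ⁻¹`. Its trace tends to `1`, hence `R - u uᵀ` tends
to zero for the unit eigenvectors `u`, and so does `R³ - R`.
-/

namespace RidgeAsymptotics

section Probability

variable {Ω : Type*} [MeasurableSpace Ω] {μ : Measure Ω}

/-- The filter on `ℕ × Ω` of the families of events whose probability tends to one. Limits along
it are limits in probability, so the calculus of `Tendsto` applies to convergence in
probability. -/
def probFilter (μ : Measure Ω) : Filter (ℕ × Ω) where
  sets := {S | Tendsto (fun N => μ {ω | (N, ω) ∉ S}) atTop (𝓝 0)}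
  univ_sets := by simp
  sets_of_superset := fun hS hST =>
    tendsto_of_tendsto_of_tendsto_of_le_of_le tendsto_const_nhds hS (fun _ => zero_le)
      fun _ => measure_mono fun _ hT h => hT (hST h)
  inter_sets := fun {S T} hS hT => by
    have hsum : Tendsto (fun N => μ {ω | (N, ω) ∉ S} + μ {ω | (N, ω) ∉ T}) atTop (𝓝 0) := by
      simpa using Tendsto.add hS hT
    refine tendsto_of_tendsto_of_tendsto_of_le_of_le tendsto_const_nhds hsum (fun _ => zero_le)
      fun N => (measure_mono fun ω hω => ?_).trans (measure_union_le _ _)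
    by_cases hωS : (N, ω) ∈ S
    · exact Or.inr fun hωT => hω ⟨hωS, hωT⟩
    · exact Or.inl hωS

lemma eventually_probFilter {p : ℕ × Ω → Prop} :
    (∀ᶠ x in probFilter μ, p x) ↔ Tendsto (fun N => μ {ω | ¬ p (N, ω)}) atTop (𝓝 0) := Iff.rfl

lemma tendsto_fst_probFilter : Tendsto Prod.fst (probFilter μ) atTop := fun S hS => by
  refine eventually_probFilter.2 (tendsto_const_nhds.congr' ?_)
  filter_upwards [hS] with N hN
  simp [hN]

lemma tendstoInMeasure_iff_probFilter {E : Type*} [PseudoMetricSpace E] {X : ℕ → Ω → E} {c : E} :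
    TendstoInMeasure μ X atTop (fun _ => c) ↔
      Tendsto (fun x => X x.1 x.2) (probFilter μ) (𝓝 c) := by
  simp only [tendstoInMeasure_iff_dist, Metric.tendsto_nhds, eventually_probFilter, not_lt,
    gt_iff_lt]

lemma tendsto_probFilter_of_ae [IsFiniteMeasure μ] {ι κ : Type*} [Finite ι] [Finite κ]
    {A : ℕ → Ω → Matrix ι κ ℝ} {B : Matrix ι κ ℝ} (hA : ∀ N i j, Measurable fun ω => A N ω i j)
    (h : ∀ᵐ ω ∂μ, Tendsto (fun N => A N ω) atTop (𝓝 B)) :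
    Tendsto (fun x => A x.1 x.2) (probFilter μ) (𝓝 B) := by
  refine tendsto_pi_nhds.2 fun i => tendsto_pi_nhds.2 fun j => ?_
  have hentry : ∀ᵐ ω ∂μ, Tendsto (fun N => A N ω i j) atTop (𝓝 (B i j)) :=
    h.mono fun ω hω => tendsto_pi_nhds.1 (tendsto_pi_nhds.1 hω i) j
  exact (tendstoInMeasure_iff_probFilter (X := fun N ω => A N ω i j)).1
    (tendstoInMeasure_of_tendsto_ae (fun N => (hA N i j).aestronglyMeasurable) hentry)

/-- `v` is Gaussian white noise: independent random variables with law `𝒩(0, σ²)`. -/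
structure IsGaussianNoise (μ : Measure Ω) (σ : ℝ) (v : ℕ → Ω → ℝ) : Prop where
  measurable : ∀ t, Measurable (v t)
  map_eq : ∀ t, μ.map (v t) = gaussianReal 0 (Real.toNNReal (σ ^ 2))
  indep : iIndepFun v μ

variable {σ : ℝ} {v : ℕ → Ω → ℝ}

lemma IsGaussianNoise.charFun_sum_mul (hv : IsGaussianNoise μ σ v) {N : ℕ} (c : Fin N → ℝ)
    (t : ℝ) :
    charFun (μ.map fun ω => ∑ i, c i * v i ω) t =
      Complex.exp (-(σ ^ 2 * (∑ i, c i ^ 2 : ℝ) * t ^ 2 / 2) : ℝ) := by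
  have hindep : iIndepFun (fun (i : Fin N) ω => c i * v i ω) μ :=
    (hv.indep.precomp (g := fun i : Fin N => (i : ℕ)) Fin.val_injective).comp
      (fun i x => c i * x) fun i => measurable_const_mul _
  have hterm : ∀ i : Fin N, charFun (μ.map fun ω => c i * v i ω) t =
      Complex.exp (-(σ ^ 2 * (c i ^ 2) * t ^ 2 / 2) : ℝ) := by
    intro i
    have hmap : μ.map (fun ω => c i * v i ω) = (μ.map (v i)).map fun x => c i * x := by
      rw [Measure.map_map (measurable_const_mul _) (hv.measurable i)]; rfl
    rw [hmap, hv.map_eq, gaussianReal_map_const_mul, charFun_gaussianReal]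
    simp only [mul_zero, Complex.ofReal_zero, zero_mul, NNReal.coe_mul, NNReal.coe_mk,
      Real.coe_toNNReal _ (sq_nonneg σ)]
    push_cast
    ring_nf
  rw [hindep.charFun_map_fun_sum_eq_prod
      fun i : Fin N => ((hv.measurable i).const_mul _).aemeasurable,
    Finset.prod_apply, Finset.prod_congr rfl fun i _ => hterm i, ← Complex.exp_sum]
  push_cast
  rw [Finset.mul_sum, Finset.sum_mul, Finset.sum_div, ← Finset.sum_neg_distrib]

variable [IsProbabilityMeasure μ]

lemma tendsto_probFilter_of_tendstoInDistribution_const {Ω' : Type*} [MeasurableSpace Ω']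
    {ν : Measure Ω'} [IsProbabilityMeasure ν] {X : ℕ → Ω → ℝ} {c : ℝ}
    (h : TendstoInDistribution X atTop (fun _ => c) (fun _ => μ) ν) :
    Tendsto (fun x => X x.1 x.2) (probFilter μ) (𝓝 c) := by
  rw [← tendstoInMeasure_iff_probFilter, tendstoInMeasure_iff_dist]
  intro ε hε
  have hclosed : IsClosed {x : ℝ | ε ≤ dist x c} :=
    isClosed_le continuous_const (continuous_id.dist continuous_const)
  have hlimsup := ProbabilityMeasure.limsup_measure_closed_le_of_tendsto h.tendsto hclosed
  have hmap : ∀ N, (μ.map (X N)) {x : ℝ | ε ≤ dist x c} = μ {ω | ε ≤ dist (X N ω) c} := fun N =>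
    Measure.map_apply_of_aemeasurable (h.forall_aemeasurable N) hclosed.measurableSet
  have hzero : (ν.map fun _ => c) {x : ℝ | ε ≤ dist x c} = 0 := by
    simp [Measure.map_const, Measure.dirac_apply' _ hclosed.measurableSet, hε]
  simp only [ProbabilityMeasure.coe_mk, hmap, hzero] at hlimsup
  exact tendsto_of_le_liminf_of_limsup_le zero_le hlimsup

lemma tendsto_mul_probFilter_zero {Ω' : Type*} [MeasurableSpace Ω'] {ν : Measure Ω'}
    [IsProbabilityMeasure ν] {X : ℕ → Ω → ℝ} {Z : Ω' → ℝ}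
    (h : TendstoInDistribution X atTop Z (fun _ => μ) ν) {a : ℕ → ℝ}
    (ha : Tendsto a atTop (𝓝 0)) :
    Tendsto (fun x => a x.1 * X x.1 x.2) (probFilter μ) (𝓝 0) := by
  have ha' : TendstoInMeasure μ (fun N _ => a N) atTop fun _ => (0 : ℝ) :=
    (tendstoInMeasure_iff_probFilter (X := fun N _ => a N)).2 (ha.comp tendsto_fst_probFilter)
  have hslutsky : TendstoInDistribution (fun N ω => a N * X N ω) atTop (fun ω => 0 * Z ω)
      (fun _ => μ) ν :=
    h.continuous_comp_prodMk_of_tendstoInMeasure_const (g := fun p : ℝ × ℝ => p.2 * p.1)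
      (by fun_prop) ha' fun _ => aemeasurable_const
  refine tendsto_probFilter_of_tendstoInDistribution_const (X := fun N ω => a N * X N ω)
    (ν := ν) ?_
  simpa only [zero_mul] using hslutsky

variable {E : Type*} [MeasurableSpace E] {f : Ω → E}

lemma charFun_map_of_indepFun {F : Type*} [MeasurableSpace F] {g : Ω → F}
    (hf : Measurable f) (hg : Measurable g) (hfg : IndepFun f g μ) {h : E → F → ℝ}
    (hh : Measurable (Function.uncurry h)) (t : ℝ) :
    charFun (μ.map fun ω => h (f ω) (g ω)) t =
      ∫ ω, charFun (μ.map fun ω' => h (f ω) (g ω')) t ∂μ := by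
  set G : E × F → ℂ := fun p => Complex.exp (t * (Function.uncurry h p : ℝ) * Complex.I) with hG
  have hGm : Measurable G := by fun_prop
  have hGbound : ∀ p, ‖G p‖ ≤ 1 := fun p => by
    simp only [hG]
    rw [← Complex.ofReal_mul, Complex.norm_exp_ofReal_mul_I]
  have hmap : ∀ {k : Ω → ℝ}, Measurable k →
      charFun (μ.map k) t = ∫ ω, Complex.exp (t * k ω * Complex.I) ∂μ := fun hk => by
    rw [charFun_apply_real, integral_map hk.aemeasurable (by fun_prop)]
  have := Measure.isProbabilityMeasure_map (μ := μ) hf.aemeasurable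
  have := Measure.isProbabilityMeasure_map (μ := μ) hg.aemeasurable
  calc charFun (μ.map fun ω => h (f ω) (g ω)) t
      = ∫ ω, G (f ω, g ω) ∂μ := hmap (hh.comp (hf.prodMk hg))
    _ = ∫ p, G p ∂((μ.map f).prod (μ.map g)) := by
      rw [← (indepFun_iff_map_prod_eq_prod_map_map hf.aemeasurable hg.aemeasurable).1 hfg,
        integral_map (hf.prodMk hg).aemeasurable hGm.aestronglyMeasurable]
    _ = ∫ x, ∫ y, G (x, y) ∂(μ.map g) ∂(μ.map f) :=
      integral_prod _ (Integrable.of_bound hGm.aestronglyMeasurable 1 (ae_of_all _ hGbound))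
    _ = ∫ ω, ∫ y, G (f ω, y) ∂(μ.map g) ∂μ :=
      integral_map hf.aemeasurable hGm.stronglyMeasurable.integral_prod_right.aestronglyMeasurable
    _ = ∫ ω, charFun (μ.map fun ω' => h (f ω) (g ω')) t ∂μ := by
      refine integral_congr_ae (ae_of_all _ fun ω => ?_)
      have hsection : Measurable fun ω' => h (f ω) (g ω') :=
        hh.comp (measurable_const.prodMk hg)
      simp only [hmap hsection]
      exact integral_map hg.aemeasurable (hGm.comp measurable_prodMk_left).aestronglyMeasurable

lemma tendsto_integral_comp_of_tendsto_probFilter {X : ℕ → Ω → ℝ} {c : ℝ}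
    (hX : ∀ N, Measurable (X N)) (h : Tendsto (fun x => X x.1 x.2) (probFilter μ) (𝓝 c))
    (g : BoundedContinuousFunction ℝ ℂ) :
    Tendsto (fun N => ∫ ω, g (X N ω) ∂μ) atTop (𝓝 (g c)) := by
  have hdist := (tendstoInMeasure_iff_probFilter.2 h).tendstoInDistribution
    fun N => (hX N).aemeasurable
  have hlim := (ProbabilityMeasure.tendsto_iff_forall_integral_rclike_tendsto ℂ).1 hdist.tendsto g
  have hmap : ∀ N, ∫ x, g x ∂(μ.map (X N)) = ∫ ω, g (X N ω) ∂μ := fun N =>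
    integral_map (hX N).aemeasurable g.continuous.measurable.aestronglyMeasurable
  have hconst : ∫ x, g x ∂(μ.map fun _ => c) = g c := by simp [Measure.map_const]
  simpa only [ProbabilityMeasure.coe_mk, hmap, hconst] using hlim

/-- Conditionally on the weights the sum is a centred Gaussian, so its characteristic function is
the mean of a bounded continuous function of the sum of the squared weights. -/
theorem IsGaussianNoise.tendstoInDistribution_sum_mul (hv : IsGaussianNoise μ σ v)
    (hf : Measurable f) (hfv : IndepFun f (fun ω t => v t ω) μ)
    {c : (N : ℕ) → E → Fin N → ℝ} (hc : ∀ N, Measurable (c N)) {τ : ℝ} (hτ : 0 ≤ τ)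
    (hlim : Tendsto (fun x => ∑ i, c x.1 (f x.2) i ^ 2) (probFilter μ) (𝓝 τ)) :
    TendstoInDistribution (fun N ω => ∑ i, c N (f ω) i * v i ω) atTop (id : ℝ → ℝ)
      (fun _ => μ) (gaussianReal 0 (Real.toNNReal (σ ^ 2 * τ))) := by
  have hvm : Measurable fun ω t => v t ω := measurable_pi_lambda _ hv.measurable
  have hci : ∀ N i, Measurable fun x => c N x i := fun N i => (measurable_pi_apply i).comp (hc N)
  have hsum : ∀ N, Measurable fun p : E × (ℕ → ℝ) => ∑ i : Fin N, c N p.1 i * p.2 i := fun N =>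
    Finset.measurable_sum _ fun i _ =>
      ((hci N i).comp measurable_fst).mul ((measurable_pi_apply _).comp measurable_snd)
  have hsq : ∀ N, Measurable fun ω => ∑ i, c N (f ω) i ^ 2 := fun N =>
    Finset.measurable_sum _ fun i _ => ((hci N i).comp hf).pow_const 2
  refine ⟨fun N => ((hsum N).comp (hf.prodMk hvm)).aemeasurable, aemeasurable_id,
    ProbabilityMeasure.tendsto_of_tendsto_charFun fun t => ?_⟩
  let g : BoundedContinuousFunction ℝ ℂ := BoundedContinuousFunction.ofNormedAddCommGroup
    (fun s => Complex.exp (-(σ ^ 2 * |s| * t ^ 2 / 2) : ℝ)) (by fun_prop) 1 fun s => by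
      rw [← Complex.ofReal_exp, Complex.norm_real, Real.norm_of_nonneg (Real.exp_pos _).le,
        Real.exp_le_one_iff, neg_nonpos]
      positivity
  have hchar : ∀ N, charFun (μ.map fun ω => ∑ i, c N (f ω) i * v i ω) t =
      ∫ ω, g (∑ i, c N (f ω) i ^ 2) ∂μ := by
    intro N
    refine (charFun_map_of_indepFun hf hvm hfv
      (h := fun x w => ∑ i : Fin N, c N x i * w i) (hsum N) t).trans ?_
    refine integral_congr_ae (ae_of_all _ fun ω => ?_)
    simp only [hv.charFun_sum_mul, g, BoundedContinuousFunction.coe_ofNormedAddCommGroup,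
      abs_of_nonneg (Finset.sum_nonneg fun i _ => sq_nonneg (c N (f ω) i))]
  have hlimit : charFun (gaussianReal 0 (Real.toNNReal (σ ^ 2 * τ))) t = g τ := by
    have hvar : 0 ≤ σ ^ 2 * τ := by positivity
    simp only [g, BoundedContinuousFunction.coe_ofNormedAddCommGroup, charFun_gaussianReal,
      abs_of_nonneg hτ, Real.coe_toNNReal _ hvar]
    push_cast
    ring_nf
  simp only [ProbabilityMeasure.coe_mk, Measure.map_id, hchar, hlimit]
  exact tendsto_integral_comp_of_tendsto_probFilter hsq hlim g

end Probability

section Spectral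

variable {ι : Type*} [Fintype ι] [DecidableEq ι]

/-- The spectral calculus attached to an orthogonal matrix `U`: the algebra homomorphism sending
`d` to `U diag(d) Uᵀ`. -/
noncomputable def spectralHom (U : unitaryGroup ι ℝ) : (ι → ℝ) →ₐ[ℝ] Matrix ι ι ℝ :=
  (Unitary.conjStarAlgAut ℝ (Matrix ι ι ℝ) U).toAlgEquiv.toAlgHom.comp (diagonalAlgHom ℝ)

variable {U : unitaryGroup ι ℝ} {A : Matrix ι ι ℝ}

lemma spectralHom_apply (d : ι → ℝ) :
    spectralHom U d = (U : Matrix ι ι ℝ) * diagonal d * (U : Matrix ι ι ℝ)ᵀ := rfl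

lemma eq_spectralHom_eigenvalues (hA : A.IsHermitian) :
    A = spectralHom hA.eigenvectorUnitary hA.eigenvalues :=
  hA.spectral_theorem

lemma transpose_mul_self_of_unitary : (U : Matrix ι ι ℝ)ᵀ * U = 1 := UnitaryGroup.star_mul_self U

lemma inv_spectralHom {d : ι → ℝ} (hd : ∀ i, d i ≠ 0) :
    (spectralHom U d)⁻¹ = spectralHom U d⁻¹ := by
  refine Matrix.inv_eq_right_inv ?_
  rw [← map_mul, show d * d⁻¹ = 1 from funext fun i => mul_inv_cancel₀ (hd i), map_one]

lemma transpose_spectralHom (d : ι → ℝ) : (spectralHom U d)ᵀ = spectralHom U d := by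
  simp only [spectralHom_apply, transpose_mul, transpose_transpose, diagonal_transpose,
    Matrix.mul_assoc]

lemma trace_spectralHom (d : ι → ℝ) : (spectralHom U d).trace = ∑ i, d i := by
  rw [spectralHom_apply, Matrix.trace_mul_comm, ← Matrix.mul_assoc, transpose_mul_self_of_unitary,
    Matrix.one_mul, Matrix.trace_diagonal]

lemma det_spectralHom (d : ι → ℝ) : (spectralHom U d).det = ∏ i, d i := by
  rw [spectralHom_apply, det_mul_comm, ← Matrix.mul_assoc, transpose_mul_self_of_unitary,
    Matrix.one_mul, det_diagonal]

lemma dotProduct_spectralHom_mulVec (d x : ι → ℝ) :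
    x ⬝ᵥ (spectralHom U d *ᵥ x) = ∑ i, d i * ((U : Matrix ι ι ℝ)ᵀ *ᵥ x) i ^ 2 := by
  rw [spectralHom_apply, ← mulVec_mulVec, ← mulVec_mulVec, dotProduct_mulVec, ← mulVec_transpose]
  simp only [dotProduct, mulVec_diagonal]
  exact Finset.sum_congr rfl fun i _ => by ring

end Spectral

lemma abs_apply_le_trace {ι : Type*} [Fintype ι] {A : Matrix ι ι ℝ} (hA : A.PosSemidef) (i j : ι) :
    |A i j| ≤ A.trace := by
  classical
  set U := hA.isHermitian.eigenvectorUnitary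
  set d := hA.isHermitian.eigenvalues
  have hentry : ∀ i j, |(U : Matrix ι ι ℝ) i j| ≤ 1 := fun i j =>
    entry_norm_bound_of_unitary U.2 i j
  have happly : A i j = ∑ k, (U : Matrix ι ι ℝ) i k * d k * (U : Matrix ι ι ℝ) j k := by
    conv_lhs => rw [eq_spectralHom_eigenvalues hA.isHermitian, spectralHom_apply, Matrix.mul_apply]
    simp only [mul_diagonal, transpose_apply, U, d]
  have htrace : A.trace = ∑ k, d k := by
    conv_lhs => rw [eq_spectralHom_eigenvalues hA.isHermitian, trace_spectralHom]
  rw [happly, htrace]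
  refine (Finset.abs_sum_le_sum_abs _ _).trans (Finset.sum_le_sum fun k _ => ?_)
  rw [abs_mul, abs_mul, abs_of_nonneg (hA.eigenvalues_nonneg k)]
  calc |(U : Matrix ι ι ℝ) i k| * d k * |(U : Matrix ι ι ℝ) j k| ≤ 1 * d k * 1 := by
        gcongr
        · exact mul_nonneg zero_le_one (hA.eigenvalues_nonneg k)
        · exact hA.eigenvalues_nonneg k
        · exact hentry i k
        · exact hentry j k
    _ = d k := by ring

section Stationarity

variable {n N : ℕ} {σ η : ℝ} {Φ : Matrix (Fin N) (Fin n) ℝ} {Y : Fin N → ℝ}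

lemma qMatrix_ridgeKernel (σ η : ℝ) (Φ : Matrix (Fin N) (Fin n) ℝ) :
    qMatrix σ Φ (ridgeKernel n η) = η • (Φ * Φᵀ) + σ ^ 2 • 1 := by
  simp [qMatrix, ridgeKernel]

lemma posDef_qMatrix_ridgeKernel (Φ : Matrix (Fin N) (Fin n) ℝ) (hσ : σ ≠ 0) (hη : 0 ≤ η) :
    (qMatrix σ Φ (ridgeKernel n η)).PosDef := by
  rw [qMatrix_ridgeKernel]
  refine PosDef.posSemidef_add ?_ (PosDef.one.smul (by positivity))
  simpa using (posSemidef_self_mul_conjTranspose Φ).smul hη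

lemma qMatrix_ridgeKernel_eq_spectralHom {V : unitaryGroup (Fin N) ℝ} {κ : Fin N → ℝ}
    (hκ : Φ * Φᵀ = spectralHom V κ) :
    qMatrix σ Φ (ridgeKernel n η) = spectralHom V fun j => η * κ j + σ ^ 2 := by
  rw [qMatrix_ridgeKernel, hκ, ← map_one (spectralHom V), ← map_smul, ← map_smul, ← map_add]
  congr 1
  ext j
  simp

/-- The first order condition of order `k` for the ridge hyper-parameter: `k = 0` belongs to the
empirical Bayes cost and `k = 1` to the `SURE_y` cost. -/
def IsStationary (k : ℕ) (σ : ℝ) (Φ : Matrix (Fin N) (Fin n) ℝ) (Y : Fin N → ℝ) (η : ℝ) : Prop :=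
  0 < η ∧ (Φ * Φᵀ * (qMatrix σ Φ (ridgeKernel n η))⁻¹ ^ (k + 1)).trace =
    Y ⬝ᵥ ((Φ * Φᵀ * (qMatrix σ Φ (ridgeKernel n η))⁻¹ ^ (k + 2)) *ᵥ Y)

lemma exists_mul_transpose_eq_spectralHom (Φ : Matrix (Fin N) (Fin n) ℝ) :
    ∃ (V : unitaryGroup (Fin N) ℝ) (κ : Fin N → ℝ), (∀ j, 0 ≤ κ j) ∧ Φ * Φᵀ = spectralHom V κ := by
  have hK : (Φ * Φᵀ).PosSemidef := posSemidef_self_mul_conjTranspose Φ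
  exact ⟨_, _, hK.eigenvalues_nonneg, eq_spectralHom_eigenvalues hK.isHermitian⟩

lemma isStationary_of_spectral {V : unitaryGroup (Fin N) ℝ} {κ : Fin N → ℝ}
    (hκ : Φ * Φᵀ = spectralHom V κ) (hκ0 : ∀ j, 0 ≤ κ j) (hσ : σ ≠ 0) (hη : 0 < η) (k : ℕ)
    (h : ∑ j, κ j / (η * κ j + σ ^ 2) ^ (k + 1) =
      ∑ j, κ j * ((V : Matrix (Fin N) (Fin N) ℝ)ᵀ *ᵥ Y) j ^ 2 / (η * κ j + σ ^ 2) ^ (k + 2)) :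
    IsStationary k σ Φ Y η := by
  have hq : ∀ j, η * κ j + σ ^ 2 ≠ 0 := fun j => by have := hκ0 j; positivity
  refine ⟨hη, ?_⟩
  rw [qMatrix_ridgeKernel_eq_spectralHom hκ, inv_spectralHom hq, hκ]
  simp only [← map_pow, ← map_mul, trace_spectralHom, dotProduct_spectralHom_mulVec]
  convert h using 2 with j _ j _
  · simp [div_eq_mul_inv]
  · simp [div_eq_mul_inv, mul_right_comm]

lemma costEB_eq_sum {V : unitaryGroup (Fin N) ℝ} {κ : Fin N → ℝ}
    (hκ : Φ * Φᵀ = spectralHom V κ) (hκ0 : ∀ j, 0 ≤ κ j) (hσ : σ ≠ 0) (hη : 0 ≤ η) :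
    costEB σ Φ Y (ridgeKernel n η) = ∑ j, (((V : Matrix (Fin N) (Fin N) ℝ)ᵀ *ᵥ Y) j ^ 2 *
      (η * κ j + σ ^ 2)⁻¹ + Real.log (η * κ j + σ ^ 2)) := by
  have hq : ∀ j, η * κ j + σ ^ 2 ≠ 0 := fun j => by have := hκ0 j; positivity
  rw [costEB, qMatrix_ridgeKernel_eq_spectralHom hκ, inv_spectralHom hq,
    dotProduct_spectralHom_mulVec, det_spectralHom, Real.log_prod fun j _ => hq j,
    ← Finset.sum_add_distrib]
  simp only [Pi.inv_apply, mul_comm]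

lemma mul_qMatrix_inv_eq {P : Matrix (Fin n) (Fin n) ℝ} (hQ : IsUnit (qMatrix σ Φ P).det) :
    Φ * P * Φᵀ * (qMatrix σ Φ P)⁻¹ = 1 - σ ^ 2 • (qMatrix σ Φ P)⁻¹ := by
  have h : Φ * P * Φᵀ = qMatrix σ Φ P - σ ^ 2 • 1 := by simp [qMatrix]
  rw [h, Matrix.sub_mul, Matrix.mul_nonsing_inv _ hQ, Matrix.smul_mul, Matrix.one_mul]

lemma costSy_eq {P : Matrix (Fin n) (Fin n) ℝ} (hQ : IsUnit (qMatrix σ Φ P).det) :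
    costSy σ Φ Y P = σ ^ 4 * (((qMatrix σ Φ P)⁻¹ *ᵥ Y) ⬝ᵥ ((qMatrix σ Φ P)⁻¹ *ᵥ Y)) +
      2 * σ ^ 2 * (N - σ ^ 2 * (qMatrix σ Φ P)⁻¹.trace) := by
  have hresidual : Y - Φ *ᵥ rlsEstimator σ Φ Y P = σ ^ 2 • ((qMatrix σ Φ P)⁻¹ *ᵥ Y) := by
    rw [rlsEstimator, mulVec_mulVec, ← Matrix.mul_assoc, ← Matrix.mul_assoc,
      mul_qMatrix_inv_eq hQ, sub_mulVec, one_mulVec, smul_mulVec, sub_sub_cancel]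
  rw [costSy, hresidual, mul_qMatrix_inv_eq hQ, trace_sub, trace_one, trace_smul, smul_dotProduct,
    dotProduct_smul, Fintype.card_fin]
  simp only [smul_eq_mul]
  ring

lemma costSy_eq_sum {V : unitaryGroup (Fin N) ℝ} {κ : Fin N → ℝ}
    (hκ : Φ * Φᵀ = spectralHom V κ) (hκ0 : ∀ j, 0 ≤ κ j) (hσ : σ ≠ 0) (hη : 0 ≤ η) :
    costSy σ Φ Y (ridgeKernel n η) = 2 * σ ^ 2 * N + σ ^ 4 * ∑ j,
      (((V : Matrix (Fin N) (Fin N) ℝ)ᵀ *ᵥ Y) j ^ 2 * (η * κ j + σ ^ 2)⁻¹ ^ 2 -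
        2 * (η * κ j + σ ^ 2)⁻¹) := by
  have hq : ∀ j, η * κ j + σ ^ 2 ≠ 0 := fun j => by have := hκ0 j; positivity
  rw [costSy_eq (posDef_qMatrix_ridgeKernel Φ hσ hη).det_pos.ne'.isUnit,
    qMatrix_ridgeKernel_eq_spectralHom hκ, inv_spectralHom hq, dotProduct_mulVec,
    ← mulVec_transpose, transpose_spectralHom, mulVec_mulVec, ← map_mul, dotProduct_comm,
    dotProduct_spectralHom_mulVec, trace_spectralHom, Finset.sum_sub_distrib, ← Finset.mul_sum]
  simp only [Pi.mul_apply, Pi.inv_apply, ← sq, mul_comm]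
  ring

lemma hasDerivAt_inv_affine {κ c : ℝ} (h : η * κ + c ≠ 0) :
    HasDerivAt (fun x => (x * κ + c)⁻¹) (-κ / (η * κ + c) ^ 2) η := by
  simpa using (((hasDerivAt_id η).mul_const κ).add_const c).fun_inv h

theorem isStationary_zero_of_isLocalMin_costEB (hσ : σ ≠ 0) (hη : 0 < η)
    (hmin : IsLocalMin (fun x => costEB σ Φ Y (ridgeKernel n x)) η) : IsStationary 0 σ Φ Y η := by
  obtain ⟨V, κ, hκ0, hκ⟩ := exists_mul_transpose_eq_spectralHom Φ
  have hq : ∀ j, η * κ j + σ ^ 2 ≠ 0 := fun j => by have := hκ0 j; positivity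
  have hcost : (fun x => costEB σ Φ Y (ridgeKernel n x)) =ᶠ[𝓝 η] _ :=
    (lt_mem_nhds hη).mono fun x hx => costEB_eq_sum hκ hκ0 hσ (le_of_lt hx)
  have hderiv := HasDerivAt.fun_sum (u := Finset.univ) fun j _ =>
    ((hasDerivAt_inv_affine (hq j)).const_mul
      (((V : Matrix (Fin N) (Fin N) ℝ)ᵀ *ᵥ Y) j ^ 2)).add
    ((((hasDerivAt_id η).mul_const (κ j)).add_const (σ ^ 2)).log (hq j))
  have hzero := (hmin.congr hcost).hasDerivAt_eq_zero hderiv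
  refine isStationary_of_spectral hκ hκ0 hσ hη 0 ?_
  rw [← sub_eq_zero, ← Finset.sum_sub_distrib, ← hzero]
  refine Finset.sum_congr rfl fun j _ => ?_
  simp only [id]
  ring

theorem isStationary_one_of_isLocalMin_costSy (hσ : σ ≠ 0) (hη : 0 < η)
    (hmin : IsLocalMin (fun x => costSy σ Φ Y (ridgeKernel n x)) η) : IsStationary 1 σ Φ Y η := by
  obtain ⟨V, κ, hκ0, hκ⟩ := exists_mul_transpose_eq_spectralHom Φ
  have hq : ∀ j, η * κ j + σ ^ 2 ≠ 0 := fun j => by have := hκ0 j; positivity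
  have hcost : (fun x => costSy σ Φ Y (ridgeKernel n x)) =ᶠ[𝓝 η] _ :=
    (lt_mem_nhds hη).mono fun x hx => costSy_eq_sum hκ hκ0 hσ (le_of_lt hx)
  have hderiv := ((HasDerivAt.fun_sum (u := Finset.univ) fun j _ =>
    (((hasDerivAt_inv_affine (hq j)).pow 2).const_mul
      (((V : Matrix (Fin N) (Fin N) ℝ)ᵀ *ᵥ Y) j ^ 2)).sub
    ((hasDerivAt_inv_affine (hq j)).const_mul 2)).const_mul (σ ^ 4)).const_add (2 * σ ^ 2 * N)
  have hzero := (hmin.congr hcost).hasDerivAt_eq_zero hderiv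
  refine isStationary_of_spectral hκ hκ0 hσ hη 1 ?_
  have hsum := (mul_eq_zero.1 hzero).resolve_left (pow_ne_zero 4 hσ)
  rw [← sub_eq_zero, ← Finset.sum_sub_distrib,
    ← mul_eq_zero_iff_left (two_ne_zero : (2 : ℝ) ≠ 0), Finset.mul_sum, ← hsum]
  refine Finset.sum_congr rfl fun j _ => ?_
  simp only [Nat.cast_ofNat, Nat.add_one_sub_one, pow_one]
  generalize η * κ j + σ ^ 2 = q
  ring

/-- The normalized Gram matrix `ΦᵀΦ / N`. -/
noncomputable def gram (Φ : Matrix (Fin N) (Fin n) ℝ) : Matrix (Fin n) (Fin n) ℝ :=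
  (N : ℝ)⁻¹ • (Φᵀ * Φ)

/-- The ordinary least squares estimator `(ΦᵀΦ)⁻¹ΦᵀY`, written with the normalized Gram
matrix. -/
noncomputable def lsEstimator (Φ : Matrix (Fin N) (Fin n) ℝ) (Y : Fin N → ℝ) : Fin n → ℝ :=
  (gram Φ)⁻¹ *ᵥ ((N : ℝ)⁻¹ • (Φᵀ *ᵥ Y))

lemma transpose_mul_inv_qMatrix_pow (hσ : σ ≠ 0) (hη : 0 ≤ η) (p : ℕ) :
    Φᵀ * (qMatrix σ Φ (ridgeKernel n η))⁻¹ ^ p =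
      (qMatrix σ Φᵀ (ridgeKernel N η))⁻¹ ^ p * Φᵀ := by
  set Q := qMatrix σ Φ (ridgeKernel n η) with hQdef
  set A := qMatrix σ Φᵀ (ridgeKernel N η) with hAdef
  have hQ : IsUnit Q.det := (posDef_qMatrix_ridgeKernel Φ hσ hη).det_pos.ne'.isUnit
  have hA : IsUnit A.det := (posDef_qMatrix_ridgeKernel Φᵀ hσ hη).det_pos.ne'.isUnit
  have hcomm : A * Φᵀ = Φᵀ * Q := by
    simp [hQdef, hAdef, qMatrix_ridgeKernel, Matrix.add_mul, Matrix.mul_add, Matrix.mul_assoc]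
  have hinv : Φᵀ * Q⁻¹ = A⁻¹ * Φᵀ := by
    rw [← Matrix.nonsing_inv_mul_cancel_left A (Φᵀ * Q⁻¹) hA, ← Matrix.mul_assoc A, hcomm,
      Matrix.mul_nonsing_inv_cancel_right _ _ hQ]
  induction p with
  | zero => simp
  | succ p ih =>
    rw [pow_succ', ← Matrix.mul_assoc, hinv, Matrix.mul_assoc, ih, pow_succ', Matrix.mul_assoc]

/-- The push-through identity `ΦᵀQ⁻ᵖ = (ηΦᵀΦ + σ²)⁻ᵖΦᵀ` moves the first order condition to the
`n`-dimensional parameter space, where it is diagonal in the eigenbasis of the Gram matrix. -/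
lemma IsStationary.trace_eq {k : ℕ} (h : IsStationary k σ Φ Y η) (hσ : σ ≠ 0) :
    (Φᵀ * Φ * (qMatrix σ Φᵀ (ridgeKernel N η))⁻¹ ^ (k + 1)).trace =
      (Φᵀ *ᵥ Y) ⬝ᵥ ((qMatrix σ Φᵀ (ridgeKernel N η))⁻¹ ^ (k + 2) *ᵥ (Φᵀ *ᵥ Y)) := by
  have hpush := transpose_mul_inv_qMatrix_pow (Φ := Φ) hσ h.1.le
  calc (Φᵀ * Φ * (qMatrix σ Φᵀ (ridgeKernel N η))⁻¹ ^ (k + 1)).trace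
      = (Φ * Φᵀ * (qMatrix σ Φ (ridgeKernel n η))⁻¹ ^ (k + 1)).trace := by
        rw [Matrix.mul_assoc, Matrix.trace_mul_comm, Matrix.mul_assoc, Matrix.trace_mul_comm,
          ← hpush, Matrix.trace_mul_comm, Matrix.mul_assoc]
    _ = Y ⬝ᵥ ((Φ * Φᵀ * (qMatrix σ Φ (ridgeKernel n η))⁻¹ ^ (k + 2)) *ᵥ Y) := h.2
    _ = _ := by
        rw [Matrix.mul_assoc, hpush, ← mulVec_mulVec, ← mulVec_mulVec, dotProduct_mulVec,
          ← mulVec_transpose]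

lemma gram_mulVec_lsEstimator (h : IsUnit (gram Φ).det) :
    gram Φ *ᵥ lsEstimator Φ Y = (N : ℝ)⁻¹ • (Φᵀ *ᵥ Y) := by
  rw [lsEstimator, mulVec_mulVec, Matrix.mul_nonsing_inv _ h, one_mulVec]

lemma inv_pow_div_add_div_pow {a m c : ℝ} (ha : a ≠ 0) (hm : m ≠ 0) (η : ℝ) (k : ℕ) :
    m⁻¹ ^ k / (η + c / (a * m)) ^ (k + 1) =
      a ^ k * (a * m * (η * (a * m) + c)⁻¹ ^ (k + 1)) := by
  have hshift : η + c / (a * m) = (η * (a * m) + c) * (a * m)⁻¹ := by field_simp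
  rw [hshift, mul_pow, div_mul_eq_div_div, inv_pow, inv_pow, inv_pow, div_inv_eq_mul]
  simp only [mul_pow, pow_succ]
  field_simp

/-- A perturbation, by the shifts `σ² / (N mᵢ)`, of `η ∑ mᵢ⁻ᵏ = ∑ mᵢ⁻ᵏ θ̃ᵢ²`. -/
theorem IsStationary.sum_eq {k : ℕ} (h : IsStationary k σ Φ Y η) (hσ : σ ≠ 0) (hN : 0 < N)
    {U : unitaryGroup (Fin n) ℝ} {m : Fin n → ℝ} (hm : ∀ i, 0 < m i)
    (hgram : gram Φ = spectralHom U m) :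
    ∑ i, (m i)⁻¹ ^ k / (η + σ ^ 2 / (N * m i)) ^ (k + 1) =
      ∑ i, (m i)⁻¹ ^ k * ((U : Matrix (Fin n) (Fin n) ℝ)ᵀ *ᵥ lsEstimator Φ Y) i ^ 2 /
        (η + σ ^ 2 / (N * m i)) ^ (k + 2) := by
  have hη := h.1
  have hN' : (0 : ℝ) < N := Nat.cast_pos.2 hN
  have hq : ∀ i, η * (N * m i) + σ ^ 2 ≠ 0 := fun i => by have := hm i; positivity
  have hG : Φᵀ * Φ = spectralHom U fun i => N * m i := by
    rw [← smul_inv_smul₀ hN'.ne' (Φᵀ * Φ), ← gram, hgram, ← map_smul]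
    rfl
  have hA : qMatrix σ Φᵀ (ridgeKernel N η) = spectralHom U fun i => η * (N * m i) + σ ^ 2 :=
    qMatrix_ridgeKernel_eq_spectralHom (by rw [transpose_transpose, hG])
  have hdet : IsUnit (gram Φ).det := by
    rw [hgram, det_spectralHom]
    exact (Finset.prod_pos fun i _ => hm i).ne'.isUnit
  have hY : Φᵀ *ᵥ Y = (Φᵀ * Φ) *ᵥ lsEstimator Φ Y := by
    rw [← smul_inv_smul₀ hN'.ne' (Φᵀ * Φ), ← gram, smul_mulVec, gram_mulVec_lsEstimator hdet,
      smul_inv_smul₀ hN'.ne']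
  have hsum := h.trace_eq hσ
  rw [hY, hA, hG, inv_spectralHom hq, dotProduct_comm, dotProduct_mulVec, ← mulVec_transpose,
    dotProduct_comm, transpose_spectralHom, mulVec_mulVec, mulVec_mulVec] at hsum
  simp only [← map_pow, ← map_mul, trace_spectralHom, dotProduct_spectralHom_mulVec, Pi.mul_apply,
    Pi.pow_apply, Pi.inv_apply] at hsum
  simp only [pow_succ (η + _) (k + 1), mul_div_mul_comm,
    inv_pow_div_add_div_pow hN'.ne' (hm _).ne', ← Finset.mul_sum, hsum]
  rw [Finset.mul_sum]
  refine Finset.sum_congr rfl fun i _ => ?_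
  have hmi := (hm i).ne'
  have hshift : η + σ ^ 2 / (N * m i) = (η * (N * m i) + σ ^ 2) / (N * m i) := by field_simp
  rw [hshift, inv_pow, inv_pow, pow_succ _ (k + 1)]
  field_simp [hq i]

end Stationarity

section PerturbedMean

variable {ι : Type*} [Fintype ι] {k : ℕ} {w y s : ι → ℝ} {S ρ η : ℝ}

lemma div_add_le_of_le_mul {s : ℝ} (hη : 0 < η) (hs : 0 < s) (hsS : s ≤ S) (hSs : S ≤ ρ * s) :
    (η + S) / (η + s) ≤ ρ := by
  have hρ : 1 ≤ ρ := le_of_mul_le_mul_right (by linarith) hs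
  rw [div_le_iff₀ (by positivity)]
  nlinarith

lemma sum_mul_le_of_sum_div_pow_eq (hw : ∀ i, 0 ≤ w i) (hy : ∀ i, 0 ≤ y i) (hs : ∀ i, 0 < s i)
    (hη : 0 < η) (hsS : ∀ i, s i ≤ S) (hSs : ∀ i, S ≤ ρ * s i)
    (heq : ∑ i, w i / (η + s i) ^ (k + 1) = ∑ i, w i * y i / (η + s i) ^ (k + 2)) :
    ∑ i, w i * y i ≤ ρ ^ (k + 1) * (η + S) * ∑ i, w i := by
  have hpos : ∀ i, 0 < η + s i := fun i => add_pos hη (hs i)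
  have hle : ∀ i, η + s i ≤ η + S := fun i => by linarith [hsS i]
  have hposS : ∀ _ : ι, 0 < η + S := fun i => (hpos i).trans_le (hle i)
  calc ∑ i, w i * y i
      ≤ ∑ i, (η + S) ^ (k + 2) * (w i * y i / (η + s i) ^ (k + 2)) := by
        refine Finset.sum_le_sum fun i _ => ?_
        rw [mul_div_left_comm, ← div_pow]
        exact le_mul_of_one_le_right (mul_nonneg (hw i) (hy i))
          (one_le_pow₀ ((one_le_div (hpos i)).2 (hle i)))
    _ = ∑ i, (η + S) ^ (k + 2) * (w i / (η + s i) ^ (k + 1)) := by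
        rw [← Finset.mul_sum, ← heq, Finset.mul_sum]
    _ ≤ ∑ i, ρ ^ (k + 1) * (η + S) * w i := by
        refine Finset.sum_le_sum fun i _ => ?_
        have hratio : ((η + S) / (η + s i)) ^ (k + 1) ≤ ρ ^ (k + 1) :=
          pow_le_pow_left₀ (div_nonneg (hposS i).le (hpos i).le)
            (div_add_le_of_le_mul hη (hs i) (hsS i) (hSs i)) _
        calc (η + S) ^ (k + 2) * (w i / (η + s i) ^ (k + 1))
            = ((η + S) / (η + s i)) ^ (k + 1) * ((η + S) * w i) := by rw [div_pow]; ring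
          _ ≤ ρ ^ (k + 1) * ((η + S) * w i) :=
            mul_le_mul_of_nonneg_right hratio (mul_nonneg (hposS i).le (hw i))
          _ = _ := by ring
    _ = _ := by rw [Finset.mul_sum]

lemma abs_div_add_pow_sub_one_le {s : ℝ} (p : ℕ) (hη : 0 < η) (hs : 0 ≤ s) (hsS : s ≤ S)
    (hSη : S ≤ η) : |((η + S) / (η + s)) ^ p - 1| ≤ p * 2 ^ (p - 1) * (S / η) := by
  have hone : 1 ≤ (η + S) / (η + s) := (one_le_div (by positivity)).2 (by linarith)
  have htwo : (η + S) / (η + s) ≤ 2 := (div_le_iff₀ (by positivity)).2 (by linarith)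
  have hsub : (η + S) / (η + s) - 1 ≤ S / η := by
    rw [div_sub_one (by positivity)]
    exact div_le_div₀ (by linarith) (by linarith) hη (by linarith)
  calc |((η + S) / (η + s)) ^ p - 1|
      ≤ |(η + S) / (η + s) - 1| * p * max |(η + S) / (η + s)| |1| ^ (p - 1) := by
        simpa only [one_pow] using abs_pow_sub_pow_le ((η + S) / (η + s)) 1 p
    _ = ((η + S) / (η + s) - 1) * p * ((η + S) / (η + s)) ^ (p - 1) := by
        rw [abs_of_nonneg (sub_nonneg.2 hone), abs_of_nonneg (zero_le_one.trans hone), abs_one,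
          max_eq_left hone]
    _ ≤ (S / η) * p * 2 ^ (p - 1) := by
        have : 0 ≤ (S / η) := (sub_nonneg.2 hone).trans hsub
        gcongr
    _ = _ := by ring

lemma sum_mul_eq_of_sum_div_pow_eq (hs : ∀ i, η + s i ≠ 0) (S : ℝ)
    (heq : ∑ i, w i / (η + s i) ^ (k + 1) = ∑ i, w i * y i / (η + s i) ^ (k + 2)) :
    ∑ i, w i * (η + s i - y i) =
      ∑ i, w i * (η + s i - y i) * (1 - ((η + S) / (η + s i)) ^ (k + 2)) := by
  have hbalance : ∑ i, w i * (η + s i - y i) * ((η + S) / (η + s i)) ^ (k + 2) = 0 := by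
    calc _ = ∑ i, (η + S) ^ (k + 2) *
          (w i / (η + s i) ^ (k + 1) - w i * y i / (η + s i) ^ (k + 2)) := by
          refine Finset.sum_congr rfl fun i _ => ?_
          have := hs i
          rw [div_pow]
          field_simp
          ring
      _ = 0 := by rw [← Finset.mul_sum, Finset.sum_sub_distrib, heq, sub_self, mul_zero]
  simp only [mul_sub (w _ * _), mul_one, Finset.sum_sub_distrib, hbalance, sub_zero]

lemma abs_sum_mul_sub_le_of_sum_div_pow_eq (hw : ∀ i, 0 ≤ w i) (hy : ∀ i, 0 ≤ y i)
    (hs : ∀ i, 0 ≤ s i) (hη : 0 < η) (hsS : ∀ i, s i ≤ S) (hSη : S ≤ η)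
    (heq : ∑ i, w i / (η + s i) ^ (k + 1) = ∑ i, w i * y i / (η + s i) ^ (k + 2)) :
    |∑ i, w i * (η + s i - y i)| ≤
      (k + 2) * 2 ^ (k + 1) * (S / η) * ∑ i, w i * (η + S + y i) := by
  have hpos : ∀ i, 0 < η + s i := fun i => add_pos_of_pos_of_nonneg hη (hs i)
  rw [sum_mul_eq_of_sum_div_pow_eq (fun i => (hpos i).ne') S heq, Finset.mul_sum]
  refine (Finset.abs_sum_le_sum_abs _ _).trans (Finset.sum_le_sum fun i _ => ?_)
  have hratio := abs_div_add_pow_sub_one_le (k + 2) hη (hs i) (hsS i) hSη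
  push_cast at hratio
  have habs : |η + s i - y i| ≤ η + S + y i :=
    abs_le.2 ⟨by linarith [hpos i, hs i, hsS i], by linarith [hy i, hsS i]⟩
  rw [abs_mul, abs_mul, abs_of_nonneg (hw i), abs_sub_comm 1, mul_comm _ (w i * _)]
  exact mul_le_mul (mul_le_mul_of_nonneg_left habs (hw i)) hratio (abs_nonneg _)
    (mul_nonneg (hw i) ((abs_nonneg _).trans habs))

/-- The comparability of the shifts `s` keeps `η` away from zero. -/
theorem abs_sub_weightedMean_le [Nonempty ι] (hw : ∀ i, 0 < w i) (hy : ∀ i, 0 ≤ y i)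
    (hs : ∀ i, 0 < s i) (hη : 0 < η) (hsS : ∀ i, s i ≤ S) (hSs : ∀ i, S ≤ ρ * s i)
    (hsmall : 2 * ρ ^ (k + 1) * S * ∑ i, w i ≤ ∑ i, w i * y i)
    (heq : ∑ i, w i / (η + s i) ^ (k + 1) = ∑ i, w i * y i / (η + s i) ^ (k + 2)) :
    |η - (∑ i, w i * y i) / ∑ i, w i| ≤ (1 + (k + 2) * 2 ^ (k + 2) * (1 + ρ ^ (k + 1))) * S := by
  obtain ⟨i₀⟩ := ‹Nonempty ι›
  have hS : 0 < S := (hs i₀).trans_le (hsS i₀)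
  have hρ : 0 < ρ := pos_of_mul_pos_left (hS.trans_le (hSs i₀)) (hs i₀).le
  have hle := sum_mul_le_of_sum_div_pow_eq (fun i => (hw i).le) hy hs hη hsS hSs heq
  have hsub := abs_sum_mul_sub_le_of_sum_div_pow_eq (fun i => (hw i).le) hy (fun i => (hs i).le) hη
    hsS (S := S) (k := k)
  set W := ∑ i, w i with hW
  set T := ∑ i, w i * y i with hT
  have hWpos : 0 < W := Finset.sum_pos (fun i _ => hw i) ⟨i₀, Finset.mem_univ _⟩
  have hTη : T ≤ 2 * ρ ^ (k + 1) * η * W := by nlinarith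
  have hSη : S ≤ η := by
    have hRW : 0 < 2 * ρ ^ (k + 1) * W := by positivity
    nlinarith [hTη]
  have hsplit : η * W - T = ∑ i, w i * (η + s i - y i) - ∑ i, w i * s i := by
    rw [hW, hT, Finset.mul_sum, ← Finset.sum_sub_distrib, ← Finset.sum_sub_distrib]
    exact Finset.sum_congr rfl fun i _ => by ring
  have hshift : |∑ i, w i * s i| ≤ S * W := by
    rw [abs_of_nonneg (Finset.sum_nonneg fun i _ => mul_nonneg (hw i).le (hs i).le), hW,
      Finset.mul_sum]
    exact Finset.sum_le_sum fun i _ => by nlinarith [hw i, hsS i]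
  have htotal : ∑ i, w i * (η + S + y i) ≤ η * (2 * (1 + ρ ^ (k + 1)) * W) := by
    simp only [mul_add, Finset.sum_add_distrib, ← Finset.sum_mul, ← hW, ← hT]
    nlinarith
  rw [sub_div' hWpos.ne', abs_div, abs_of_pos hWpos, div_le_iff₀ hWpos, hsplit]
  calc _ ≤ (k + 2) * 2 ^ (k + 1) * (S / η) * (η * (2 * (1 + ρ ^ (k + 1)) * W)) + S * W :=
        (abs_sub _ _).trans (add_le_add ((hsub hSη heq).trans (by gcongr)) hshift)
    _ = _ := by field_simp; ring

end PerturbedMean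

section Gram

variable {n N : ℕ} {σ η : ℝ} {Φ : Matrix (Fin N) (Fin n) ℝ} {Y : Fin N → ℝ}

lemma posDef_gram (h : IsUnit (gram Φ).det) : (gram Φ).PosDef := by
  have hpsd : (gram Φ).PosSemidef :=
    (posSemidef_conjTranspose_mul_self Φ).smul (inv_nonneg.2 N.cast_nonneg)
  exact hpsd.posDef_iff_isUnit.2 ((isUnit_iff_isUnit_det _).2 h)

lemma pos_of_isUnit_det_gram (hn : 0 < n) (h : IsUnit (gram Φ).det) : 0 < N := by
  have : Nonempty (Fin n) := ⟨⟨0, hn⟩⟩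
  refine Nat.pos_of_ne_zero ?_
  rintro rfl
  simp [gram, isUnit_iff_ne_zero] at h

/-- The value at which the first order condition with weight matrix `J` balances for the
parameter `θ`, up to the vanishing shift by the noise level: `θᵀJθ / Tr J`. -/
noncomputable def ridgeTarget (J : Matrix (Fin n) (Fin n) ℝ) (θ : Fin n → ℝ) : ℝ :=
  θ ⬝ᵥ (J *ᵥ θ) / J.trace

lemma div_mul_le_and_le_of_bounds {a m c B : ℝ} (ha : 0 < a) (hm : 0 < m) (hc : 0 ≤ c) (hB : m ≤ B)
    (hB' : m⁻¹ ≤ B) : c / (a * m) ≤ c * B / a ∧ c * B / a ≤ B ^ 2 * (c / (a * m)) := by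
  have hsplit : c / (a * m) = c / a * m⁻¹ := by field_simp
  have hB0 : 0 < B := hm.trans_le hB
  have hone : 1 ≤ B * m⁻¹ := by rwa [← div_eq_mul_inv, one_le_div hm]
  rw [hsplit, mul_div_right_comm]
  refine ⟨by gcongr, ?_⟩
  calc c / a * B ≤ c / a * B * (B * m⁻¹) := le_mul_of_one_le_right (by positivity) hone
    _ = B ^ 2 * (c / a * m⁻¹) := by ring

theorem IsStationary.abs_sub_ridgeTarget_le {k : ℕ} {B : ℝ} (h : IsStationary k σ Φ Y η)
    (hσ : σ ≠ 0) (hn : 0 < n) (hgram : (gram Φ).PosDef) (hB : (gram Φ).trace ≤ B)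
    (hB' : (gram Φ)⁻¹.trace ≤ B)
    (hsmall : 2 * (B ^ 2) ^ (k + 1) * (σ ^ 2 * B / N) * ((gram Φ)⁻¹ ^ k).trace ≤
      lsEstimator Φ Y ⬝ᵥ ((gram Φ)⁻¹ ^ k *ᵥ lsEstimator Φ Y)) :
    |η - ridgeTarget ((gram Φ)⁻¹ ^ k) (lsEstimator Φ Y)| ≤
      (1 + (k + 2) * 2 ^ (k + 2) * (1 + (B ^ 2) ^ (k + 1))) * (σ ^ 2 * B / N) := by
  have : Nonempty (Fin n) := ⟨⟨0, hn⟩⟩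
  have hN : 0 < N := pos_of_isUnit_det_gram hn hgram.det_pos.ne'.isUnit
  have hN' : (0 : ℝ) < N := Nat.cast_pos.2 hN
  set U := hgram.isHermitian.eigenvectorUnitary
  set m := hgram.isHermitian.eigenvalues
  have hm : ∀ i, 0 < m i := hgram.eigenvalues_pos
  have hU : gram Φ = spectralHom U m := eq_spectralHom_eigenvalues hgram.isHermitian
  have hUinv : (gram Φ)⁻¹ = spectralHom U m⁻¹ := by
    rw [hU, inv_spectralHom fun i => (hm i).ne']
  have hmB : ∀ i, m i ≤ B := fun i => by
    rw [hU, trace_spectralHom] at hB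
    exact (Finset.single_le_sum (fun j _ => (hm j).le) (Finset.mem_univ i)).trans hB
  have hmB' : ∀ i, (m i)⁻¹ ≤ B := fun i => by
    rw [hUinv, trace_spectralHom] at hB'
    exact (Finset.single_le_sum (f := m⁻¹) (fun j _ => (inv_pos.2 (hm j)).le)
      (Finset.mem_univ i)).trans hB'
  have hshift := fun i => div_mul_le_and_le_of_bounds hN' (hm i) (sq_nonneg σ) (hmB i) (hmB' i)
  simp only [ridgeTarget, hUinv, ← map_pow, trace_spectralHom, dotProduct_spectralHom_mulVec]
    at hsmall ⊢
  exact abs_sub_weightedMean_le (fun i => pow_pos (inv_pos.2 (hm i)) k) (fun i => sq_nonneg _)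
    (fun i => div_pos (by positivity) (mul_pos hN' (hm i))) h.1
    (fun i => (hshift i).1) (fun i => (hshift i).2) hsmall (h.sum_eq hσ hN hm hU)

end Gram

section Measurability

variable {m n : ℕ}

local instance : MeasurableSpace (Matrix (Fin m) (Fin n) ℝ) := MeasurableSpace.pi
local instance : BorelSpace (Matrix (Fin m) (Fin n) ℝ) := Pi.borelSpace

lemma measurable_matrix_inv : Measurable fun M : Matrix (Fin n) (Fin n) ℝ => M⁻¹ := by
  have hdet : Measurable fun M : Matrix (Fin n) (Fin n) ℝ => M.det⁻¹ :=
    continuous_id.matrix_det.measurable.inv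
  have hadj : Measurable fun M : Matrix (Fin n) (Fin n) ℝ => M.adjugate :=
    continuous_id.matrix_adjugate.measurable
  have hinv : (fun M : Matrix (Fin n) (Fin n) ℝ => M⁻¹) =
      fun M i j => M.det⁻¹ * M.adjugate i j := by
    funext M i j
    simp [Matrix.inv_def]
  rw [hinv]
  exact measurable_pi_lambda _ fun i => measurable_pi_lambda _ fun j => hdet.mul <|
    (measurable_pi_apply j).comp ((measurable_pi_apply i).comp hadj)

lemma measurable_mulVec {E : Type*} [MeasurableSpace E] {M : E → Matrix (Fin m) (Fin n) ℝ}
    {x : E → Fin n → ℝ} (hM : Measurable M) (hx : Measurable x) :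
    Measurable fun e => M e *ᵥ x e :=
  (continuous_fst.matrix_mulVec continuous_snd).measurable2 hM hx

lemma continuous_regMatrix (N : ℕ) : Continuous fun f : ℕ → Fin n → ℝ => regMatrix f N := by
  unfold regMatrix
  fun_prop

lemma continuous_gram_regMatrix (N : ℕ) :
    Continuous fun f : ℕ → Fin n → ℝ => gram (regMatrix f N) :=
  (((continuous_regMatrix N).matrix_transpose).matrix_mul
    (continuous_regMatrix N)).const_smul (N : ℝ)⁻¹

lemma measurable_gram_regMatrix_inv (N : ℕ) :
    Measurable fun f : ℕ → Fin n → ℝ => (gram (regMatrix f N))⁻¹ :=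
  measurable_matrix_inv.comp (continuous_gram_regMatrix N).measurable

lemma measurable_regMatrix_mulVec_gram_inv (N : ℕ) {a : (ℕ → Fin n → ℝ) → Fin n → ℝ}
    (ha : Measurable a) :
    Measurable fun f => regMatrix f N *ᵥ ((gram (regMatrix f N))⁻¹ *ᵥ a f) :=
  measurable_mulVec (continuous_regMatrix N).measurable
    (measurable_mulVec (measurable_gram_regMatrix_inv N) ha)

lemma measurable_gram_inv_pow_mulVec_div (N k : ℕ) (θ : Fin n → ℝ) :
    Measurable fun f : ℕ → Fin n → ℝ => (2 / ((gram (regMatrix f N))⁻¹ ^ k).trace) •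
      ((gram (regMatrix f N))⁻¹ ^ k *ᵥ θ) := by
  have hpow : Measurable fun f : ℕ → Fin n → ℝ => (gram (regMatrix f N))⁻¹ ^ k :=
    (continuous_pow k).measurable.comp (measurable_gram_regMatrix_inv N)
  exact ((continuous_id.matrix_trace.measurable.comp hpow).const_div 2).smul
    (measurable_mulVec hpow measurable_const)

end Measurability

section Regression

variable {n N : ℕ} {Φ : Matrix (Fin N) (Fin n) ℝ}

lemma tendsto_dotProduct {α : Type*} {l : Filter α} {x y : α → Fin n → ℝ} {x₀ y₀ : Fin n → ℝ}
    (hx : Tendsto x l (𝓝 x₀)) (hy : Tendsto y l (𝓝 y₀)) :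
    Tendsto (fun i => x i ⬝ᵥ y i) l (𝓝 (x₀ ⬝ᵥ y₀)) :=
  ((continuous_fst.dotProduct continuous_snd).tendsto (x₀, y₀)).comp (hx.prodMk_nhds hy)

lemma tendsto_mulVec {α : Type*} {l : Filter α} {M : α → Matrix (Fin n) (Fin n) ℝ}
    {x : α → Fin n → ℝ} {M₀ : Matrix (Fin n) (Fin n) ℝ} {x₀ : Fin n → ℝ}
    (hM : Tendsto M l (𝓝 M₀)) (hx : Tendsto x l (𝓝 x₀)) :
    Tendsto (fun i => M i *ᵥ x i) l (𝓝 (M₀ *ᵥ x₀)) :=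
  ((continuous_fst.matrix_mulVec continuous_snd).tendsto (M₀, x₀)).comp (hM.prodMk_nhds hx)

lemma tendsto_trace {α : Type*} {l : Filter α} {M : α → Matrix (Fin n) (Fin n) ℝ}
    {M₀ : Matrix (Fin n) (Fin n) ℝ} (hM : Tendsto M l (𝓝 M₀)) :
    Tendsto (fun i => (M i).trace) l (𝓝 M₀.trace) :=
  (continuous_id.matrix_trace.tendsto M₀).comp hM

lemma transpose_gram (Φ : Matrix (Fin N) (Fin n) ℝ) : (gram Φ)ᵀ = gram Φ := by
  simp [gram]

lemma transpose_inv_gram (Φ : Matrix (Fin N) (Fin n) ℝ) : (gram Φ)⁻¹ᵀ = (gram Φ)⁻¹ := by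
  rw [transpose_nonsing_inv, transpose_gram]

lemma lsEstimator_mulVec_add (h : IsUnit (gram Φ).det) (θ : Fin n → ℝ) (V : Fin N → ℝ) :
    lsEstimator Φ (Φ *ᵥ θ + V) = θ + lsEstimator Φ V := by
  rw [lsEstimator, mulVec_add, smul_add, mulVec_add, mulVec_mulVec, ← smul_mulVec, mulVec_mulVec,
    ← gram, Matrix.nonsing_inv_mul _ h, one_mulVec, lsEstimator]

lemma dotProduct_sqrt_smul_lsEstimator (Φ : Matrix (Fin N) (Fin n) ℝ) (a : Fin n → ℝ)
    (V : Fin N → ℝ) :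
    a ⬝ᵥ (√N • lsEstimator Φ V) = ((√N)⁻¹ • (Φ *ᵥ ((gram Φ)⁻¹ *ᵥ a))) ⬝ᵥ V := by
  have hadj : (Φ *ᵥ ((gram Φ)⁻¹ *ᵥ a)) ⬝ᵥ V = a ⬝ᵥ ((gram Φ)⁻¹ *ᵥ (Φᵀ *ᵥ V)) := by
    rw [dotProduct_comm, dotProduct_mulVec, ← mulVec_transpose, dotProduct_mulVec,
      ← mulVec_transpose, transpose_inv_gram, dotProduct_comm]
  rw [lsEstimator, mulVec_smul, dotProduct_smul, dotProduct_smul, smul_dotProduct, hadj, smul_smul,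
    ← div_eq_mul_inv, Real.sqrt_div_self']
  simp

lemma dotProduct_self_errorWeight (h : IsUnit (gram Φ).det) (a : Fin n → ℝ) :
    ((√N)⁻¹ • (Φ *ᵥ ((gram Φ)⁻¹ *ᵥ a))) ⬝ᵥ ((√N)⁻¹ • (Φ *ᵥ ((gram Φ)⁻¹ *ᵥ a))) =
      a ⬝ᵥ ((gram Φ)⁻¹ *ᵥ a) := by
  have hsq : (√(N : ℝ))⁻¹ * (√(N : ℝ))⁻¹ = (N : ℝ)⁻¹ := by
    rw [← mul_inv, Real.mul_self_sqrt N.cast_nonneg]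
  set b := (gram Φ)⁻¹ *ᵥ a with hb
  have hgram : gram Φ *ᵥ b = a := by
    rw [hb, mulVec_mulVec, Matrix.mul_nonsing_inv _ h, one_mulVec]
  rw [smul_dotProduct, dotProduct_smul, smul_smul, hsq, dotProduct_mulVec, ← mulVec_transpose,
    mulVec_mulVec, ← smul_dotProduct, ← smul_mulVec, ← gram, hgram]

variable {Ω : Type*} [MeasurableSpace Ω] {μ : Measure Ω} {σ : ℝ} {φ : ℕ → Ω → Fin n → ℝ}
  {v : ℕ → Ω → ℝ} {Sig : Matrix (Fin n) (Fin n) ℝ} {θ₀ : Fin n → ℝ}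

/-- The normalized Gram matrix of the first `N` regressors, as a function of `(N, ω)`. -/
noncomputable def sampleGram (φ : ℕ → Ω → Fin n → ℝ) (x : ℕ × Ω) : Matrix (Fin n) (Fin n) ℝ :=
  gram (regMatrix (fun t => φ t x.2) x.1)

/-- The error `√N (θ̂ - θ₀)` of the least squares estimator, as a function of `(N, ω)`; by linearity
it is `√N` times the estimator applied to the noise. -/
noncomputable def scaledError (φ : ℕ → Ω → Fin n → ℝ) (v : ℕ → Ω → ℝ) (x : ℕ × Ω) : Fin n → ℝ :=
  √x.1 • lsEstimator (regMatrix (fun t => φ t x.2) x.1) fun t => v t x.2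

/-- The assumptions on the linear regression model: Gaussian noise, regressors independent of it,
and normalized Gram matrices that converge in probability to a positive definite `Sig`. -/
structure IsRegressionModel (μ : Measure Ω) (σ : ℝ) (φ : ℕ → Ω → Fin n → ℝ) (v : ℕ → Ω → ℝ)
    (Sig : Matrix (Fin n) (Fin n) ℝ) : Prop where
  noise : IsGaussianNoise μ σ v
  measurable : ∀ t, Measurable (φ t)
  indepFun : IndepFun (fun ω t => φ t ω) (fun ω t => v t ω) μ
  posDef : Sig.PosDef
  tendsto_gram : Tendsto (sampleGram φ) (probFilter μ) (𝓝 Sig)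

namespace IsRegressionModel

lemma of_ae_tendsto [IsFiniteMeasure μ] (noise : IsGaussianNoise μ σ v)
    (measurable : ∀ t, Measurable (φ t))
    (indepFun : IndepFun (fun ω t => φ t ω) (fun ω t => v t ω) μ) (posDef : Sig.PosDef)
    (hgram : ∀ᵐ ω ∂μ, Tendsto (fun N => sampleGram φ (N, ω)) atTop (𝓝 Sig)) :
    IsRegressionModel μ σ φ v Sig := by
  refine ⟨noise, measurable, indepFun, posDef,
    tendsto_probFilter_of_ae (A := fun N ω => sampleGram φ (N, ω)) (fun N i j => ?_) hgram⟩
  exact ((continuous_gram_regMatrix N).matrix_elem i j).measurable.comp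
    (measurable_pi_lambda _ measurable)

lemma eventually_isUnit_det (h : IsRegressionModel μ σ φ v Sig) :
    ∀ᶠ x in probFilter μ, IsUnit (sampleGram φ x).det :=
  (((continuous_id.matrix_det.tendsto Sig).comp h.tendsto_gram).eventually_ne
    h.posDef.det_pos.ne').mono fun _ => Ne.isUnit

lemma tendsto_inv_gram (h : IsRegressionModel μ σ φ v Sig) :
    Tendsto (fun x => (sampleGram φ x)⁻¹) (probFilter μ) (𝓝 Sig⁻¹) :=
  (continuousAt_matrix_inv Sig (NormedRing.inverse_continuousAt
    h.posDef.det_pos.ne'.isUnit.unit)).tendsto.comp h.tendsto_gram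

variable [IsProbabilityMeasure μ]

theorem tendstoInDistribution_dotProduct_scaledError (h : IsRegressionModel μ σ φ v Sig)
    {a : ℕ → (ℕ → Fin n → ℝ) → Fin n → ℝ} (ha : ∀ N, Measurable (a N)) {a₀ : Fin n → ℝ}
    (hlim : Tendsto (fun x : ℕ × Ω => a x.1 fun t => φ t x.2) (probFilter μ) (𝓝 a₀)) :
    TendstoInDistribution (fun N ω => (a N fun t => φ t ω) ⬝ᵥ scaledError φ v (N, ω)) atTop
      (id : ℝ → ℝ) (fun _ => μ)
      (gaussianReal 0 (Real.toNNReal (σ ^ 2 * (a₀ ⬝ᵥ (Sig⁻¹ *ᵥ a₀))))) := by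
  have hsq : Tendsto (fun x : ℕ × Ω => ∑ i, ((√x.1)⁻¹ • (regMatrix (fun t => φ t x.2) x.1 *ᵥ
      ((sampleGram φ x)⁻¹ *ᵥ a x.1 fun t => φ t x.2))) i ^ 2) (probFilter μ)
      (𝓝 (a₀ ⬝ᵥ (Sig⁻¹ *ᵥ a₀))) := by
    refine (tendsto_dotProduct hlim (tendsto_mulVec h.tendsto_inv_gram hlim)).congr' ?_
    filter_upwards [h.eventually_isUnit_det] with x hx
    simp only [sq]
    exact (dotProduct_self_errorWeight hx _).symm
  have hτ : 0 ≤ a₀ ⬝ᵥ (Sig⁻¹ *ᵥ a₀) := by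
    simpa using h.posDef.inv.posSemidef.dotProduct_mulVec_nonneg a₀
  have hclt := h.noise.tendstoInDistribution_sum_mul (measurable_pi_lambda _ h.measurable)
    h.indepFun (fun N => (measurable_regMatrix_mulVec_gram_inv N (ha N)).const_smul (√N)⁻¹)
    hτ hsq
  convert hclt using 3
  exact dotProduct_sqrt_smul_lsEstimator _ _ _

lemma tendsto_smul_scaledError (h : IsRegressionModel μ σ φ v Sig) {r : ℕ → ℝ}
    (hr : Tendsto r atTop (𝓝 0)) :
    Tendsto (fun x => r x.1 • scaledError φ v x) (probFilter μ) (𝓝 0) := by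
  refine tendsto_pi_nhds.2 fun i => ?_
  have hclt := h.tendstoInDistribution_dotProduct_scaledError (a := fun _ _ => Pi.single i 1)
    (fun _ => measurable_const) tendsto_const_nhds
  simpa using tendsto_mul_probFilter_zero hclt hr

end IsRegressionModel

end Regression

section Normality

variable {n : ℕ}

lemma mul_ridgeTarget_sub_eq {J J₀ : Matrix (Fin n) (Fin n) ℝ} {θ e : Fin n → ℝ} {s : ℝ}
    (hs : s ≠ 0) (hJ : Jᵀ = J) (hJ0 : J.trace ≠ 0) (hJ₀0 : J₀.trace ≠ 0) :
    s * (ridgeTarget J (θ + s⁻¹ • e) - ridgeTarget J₀ θ) - ((2 / J.trace) • (J *ᵥ θ)) ⬝ᵥ e =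
      (θ ⬝ᵥ ((s • (J - J₀)) *ᵥ θ) - ridgeTarget J₀ θ * (s • (J - J₀)).trace +
        s⁻¹ * (e ⬝ᵥ (J *ᵥ e))) / J.trace := by
  have hsymm : e ⬝ᵥ (J *ᵥ θ) = θ ⬝ᵥ (J *ᵥ e) := by
    rw [dotProduct_mulVec, ← mulVec_transpose, hJ, dotProduct_comm]
  simp only [ridgeTarget, smul_mulVec, sub_mulVec, mulVec_add, mulVec_smul, add_dotProduct,
    dotProduct_add, smul_dotProduct, dotProduct_smul, dotProduct_sub, trace_smul, trace_sub,
    smul_eq_mul, dotProduct_comm (J *ᵥ θ) e, hsymm]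
  field_simp
  ring

variable {Ω : Type*} [MeasurableSpace Ω] {μ : Measure Ω} {σ : ℝ} {φ : ℕ → Ω → Fin n → ℝ}
  {v : ℕ → Ω → ℝ} {Sig : Matrix (Fin n) (Fin n) ℝ} {θ₀ : Fin n → ℝ} {k : ℕ}

/-- The least squares estimate of `θ₀` from the first `N` data, as a function of `(N, ω)`. -/
noncomputable def sampleEstimate (φ : ℕ → Ω → Fin n → ℝ) (v : ℕ → Ω → ℝ) (θ₀ : Fin n → ℝ)
    (x : ℕ × Ω) : Fin n → ℝ :=
  lsEstimator (regMatrix (fun t => φ t x.2) x.1)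
    (outputVec (fun t => φ t x.2) (fun t => v t x.2) θ₀ x.1)

lemma eventually_pos_probFilter : ∀ᶠ x in probFilter μ, 0 < x.1 :=
  tendsto_fst_probFilter.eventually (eventually_gt_atTop 0)

lemma posDef_pow {A : Matrix (Fin n) (Fin n) ℝ} (hA : A.PosDef) (k : ℕ) : (A ^ k).PosDef :=
  (hA.posSemidef.pow k).posDef_iff_isUnit.2 (hA.isUnit.pow k)

lemma trace_pow_pos {A : Matrix (Fin n) (Fin n) ℝ} (hn : 0 < n) (hA : A.PosDef) (k : ℕ) :
    0 < (A ^ k).trace :=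
  have : Nonempty (Fin n) := ⟨⟨0, hn⟩⟩
  (posDef_pow hA k).trace_pos

lemma tendsto_inv_sqrt : Tendsto (fun N : ℕ => (√N)⁻¹) atTop (𝓝 0) :=
  tendsto_inv_atTop_zero.comp (Real.tendsto_sqrt_atTop.comp tendsto_natCast_atTop_atTop)

namespace IsRegressionModel

lemma eventually_sampleEstimate_eq (h : IsRegressionModel μ σ φ v Sig) (θ₀ : Fin n → ℝ) :
    ∀ᶠ x in probFilter μ,
      sampleEstimate φ v θ₀ x = θ₀ + (√x.1)⁻¹ • scaledError φ v x := by
  filter_upwards [h.eventually_isUnit_det, eventually_pos_probFilter] with x hx hN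
  have hsqrt : √(x.1 : ℝ) ≠ 0 := (Real.sqrt_pos.2 (Nat.cast_pos.2 hN)).ne'
  rw [sampleEstimate, outputVec, lsEstimator_mulVec_add hx, scaledError, inv_smul_smul₀ hsqrt]

lemma tendsto_pow_inv_gram (h : IsRegressionModel μ σ φ v Sig) (k : ℕ) :
    Tendsto (fun x => (sampleGram φ x)⁻¹ ^ k) (probFilter μ) (𝓝 (Sig⁻¹ ^ k)) :=
  h.tendsto_inv_gram.pow k

variable [IsProbabilityMeasure μ]

lemma tendsto_sampleEstimate (h : IsRegressionModel μ σ φ v Sig) (θ₀ : Fin n → ℝ) :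
    Tendsto (sampleEstimate φ v θ₀) (probFilter μ) (𝓝 θ₀) := by
  have herror := (h.tendsto_smul_scaledError tendsto_inv_sqrt).const_add θ₀
  rw [add_zero] at herror
  exact herror.congr' ((h.eventually_sampleEstimate_eq θ₀).mono fun _ hx => hx.symm)

lemma tendsto_sqrt_mul_sub_ridgeTarget (h : IsRegressionModel μ σ φ v Sig) (hn : 0 < n)
    (hσ : σ ≠ 0) (hθ : θ₀ ≠ 0) {η : ℕ → Ω → ℝ}
    (hη : ∀ᶠ x in probFilter μ, IsStationary k σ (regMatrix (fun t => φ t x.2) x.1)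
      (outputVec (fun t => φ t x.2) (fun t => v t x.2) θ₀ x.1) (η x.1 x.2)) :
    Tendsto (fun x => √x.1 * (η x.1 x.2 -
      ridgeTarget ((sampleGram φ x)⁻¹ ^ k) (sampleEstimate φ v θ₀ x))) (probFilter μ) (𝓝 0) := by
  set B := max Sig.trace Sig⁻¹.trace + 1
  have hB : ∀ᶠ x in probFilter μ, (sampleGram φ x).trace < B :=
    (tendsto_trace h.tendsto_gram).eventually_lt_const ((le_max_left _ _).trans_lt (lt_add_one _))
  have hB' : ∀ᶠ x in probFilter μ, (sampleGram φ x)⁻¹.trace < B :=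
    (tendsto_trace h.tendsto_inv_gram).eventually_lt_const
      ((le_max_right _ _).trans_lt (lt_add_one _))
  have hinv : Tendsto (fun x : ℕ × Ω => σ ^ 2 * B / x.1) (probFilter μ) (𝓝 0) :=
    (tendsto_const_div_atTop_nhds_zero_nat _).comp tendsto_fst_probFilter
  have hpos : 0 < θ₀ ⬝ᵥ (Sig⁻¹ ^ k *ᵥ θ₀) := by
    simpa using (posDef_pow h.posDef.inv k).dotProduct_mulVec_pos hθ
  have hlhs := (hinv.const_mul (2 * (B ^ 2) ^ (k + 1))).mul
    (tendsto_trace (h.tendsto_pow_inv_gram k))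
  rw [mul_zero, zero_mul] at hlhs
  have hrhs := tendsto_dotProduct (h.tendsto_sampleEstimate θ₀)
    (tendsto_mulVec (h.tendsto_pow_inv_gram k) (h.tendsto_sampleEstimate θ₀))
  have hbound : Tendsto (fun x : ℕ × Ω => (1 + (k + 2) * 2 ^ (k + 2) * (1 + (B ^ 2) ^ (k + 1))) *
      (σ ^ 2 * B) * (√x.1)⁻¹) (probFilter μ) (𝓝 0) := by
    simpa using (tendsto_inv_sqrt.comp tendsto_fst_probFilter).const_mul _
  refine squeeze_zero_norm' ?_ hbound
  filter_upwards [hη, hB, hB', hlhs.eventually_lt hrhs hpos, h.eventually_isUnit_det] with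
    x hx hxB hxB' hxlt hxunit
  have hle := hx.abs_sub_ridgeTarget_le hσ hn (posDef_gram hxunit) hxB.le hxB'.le hxlt.le
  rw [Real.norm_eq_abs, abs_mul, abs_of_nonneg (Real.sqrt_nonneg _)]
  refine (mul_le_mul_of_nonneg_left hle (Real.sqrt_nonneg _)).trans_eq ?_
  rw [← Real.sqrt_div_self]
  ring

/-- The delta method: to first order the target at the least squares estimate is linear in the
error, and the quadratic remainder is handled by `N^{-1/4} • scaledError → 0`. -/
lemma tendsto_sqrt_mul_ridgeTarget_sub (h : IsRegressionModel μ σ φ v Sig) (hn : 0 < n)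
    (hrate : Tendsto (fun x => √x.1 • ((sampleGram φ x)⁻¹ ^ k - Sig⁻¹ ^ k)) (probFilter μ)
      (𝓝 0)) :
    Tendsto (fun x => √x.1 * (ridgeTarget ((sampleGram φ x)⁻¹ ^ k) (sampleEstimate φ v θ₀ x) -
      ridgeTarget (Sig⁻¹ ^ k) θ₀) - ((2 / ((sampleGram φ x)⁻¹ ^ k).trace) •
        ((sampleGram φ x)⁻¹ ^ k *ᵥ θ₀)) ⬝ᵥ scaledError φ v x) (probFilter μ) (𝓝 0) := by
  have htrace : (Sig⁻¹ ^ k).trace ≠ 0 := (trace_pow_pos hn h.posDef.inv k).ne'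
  have hJ := h.tendsto_pow_inv_gram k
  have hroot : Tendsto (fun N : ℕ => √(√N)⁻¹) atTop (𝓝 0) := by
    simpa using tendsto_inv_sqrt.sqrt
  have herror := h.tendsto_smul_scaledError hroot
  have hquad := tendsto_dotProduct herror (tendsto_mulVec hJ herror)
  have hθ : Tendsto (fun _ => θ₀) (probFilter μ) (𝓝 θ₀) := tendsto_const_nhds
  have hlimit := (((tendsto_dotProduct hθ (tendsto_mulVec hrate hθ)).sub
    ((tendsto_trace hrate).const_mul (ridgeTarget (Sig⁻¹ ^ k) θ₀))).add hquad).div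
      (tendsto_trace hJ) htrace
  simp only [zero_mulVec, dotProduct_zero, trace_zero, mul_zero, mulVec_zero, sub_zero, add_zero,
    zero_div] at hlimit
  refine hlimit.congr' ?_
  filter_upwards [h.eventually_sampleEstimate_eq θ₀, eventually_pos_probFilter,
    (tendsto_trace hJ).eventually_ne htrace] with x hx hN hxtrace
  have hsqrt : √(x.1 : ℝ) ≠ 0 := (Real.sqrt_pos.2 (Nat.cast_pos.2 hN)).ne'
  have hsymm : ((sampleGram φ x)⁻¹ ^ k)ᵀ = (sampleGram φ x)⁻¹ ^ k := by
    rw [transpose_pow, sampleGram, transpose_inv_gram]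
  rw [hx, mul_ridgeTarget_sub_eq hsqrt hsymm hxtrace htrace]
  simp only [Pi.div_apply, mulVec_smul, smul_dotProduct, dotProduct_smul, smul_eq_mul]
  rw [← mul_assoc, Real.mul_self_sqrt (by positivity)]

theorem tendstoInDistribution_of_isStationary (h : IsRegressionModel μ σ φ v Sig) (hn : 0 < n)
    (hσ : σ ≠ 0) (hθ : θ₀ ≠ 0) {η : ℕ → Ω → ℝ} (hηm : ∀ N, Measurable (η N))
    (hη : ∀ᶠ x in probFilter μ, IsStationary k σ (regMatrix (fun t => φ t x.2) x.1)
      (outputVec (fun t => φ t x.2) (fun t => v t x.2) θ₀ x.1) (η x.1 x.2))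
    (hrate : Tendsto (fun x => √x.1 • ((sampleGram φ x)⁻¹ ^ k - Sig⁻¹ ^ k)) (probFilter μ)
      (𝓝 0)) :
    TendstoInDistribution (fun (N : ℕ) ω => √N * (η N ω - ridgeTarget (Sig⁻¹ ^ k) θ₀)) atTop
      (id : ℝ → ℝ) (fun _ => μ) (gaussianReal 0 (Real.toNNReal
        (4 * σ ^ 2 / (Sig⁻¹ ^ k).trace ^ 2 * (θ₀ ⬝ᵥ (Sig⁻¹ ^ (2 * k + 1) *ᵥ θ₀))))) := by
  have hJ := h.tendsto_pow_inv_gram k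
  have htrace : (Sig⁻¹ ^ k).trace ≠ 0 := (trace_pow_pos hn h.posDef.inv k).ne'
  have hclt := h.tendstoInDistribution_dotProduct_scaledError
    (fun N => measurable_gram_inv_pow_mulVec_div N k θ₀)
    (((tendsto_const_nhds (x := (2 : ℝ))).div (tendsto_trace hJ) htrace).smul
      (tendsto_mulVec hJ tendsto_const_nhds))
  have hvariance : σ ^ 2 * (((2 / (Sig⁻¹ ^ k).trace) • (Sig⁻¹ ^ k *ᵥ θ₀)) ⬝ᵥ
      (Sig⁻¹ *ᵥ ((2 / (Sig⁻¹ ^ k).trace) • (Sig⁻¹ ^ k *ᵥ θ₀)))) =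
      4 * σ ^ 2 / (Sig⁻¹ ^ k).trace ^ 2 * (θ₀ ⬝ᵥ (Sig⁻¹ ^ (2 * k + 1) *ᵥ θ₀)) := by
    set J := Sig⁻¹ ^ k with hJdef
    have hsymm : (Sig⁻¹ ^ k)ᵀ = Sig⁻¹ ^ k := (posDef_pow h.posDef.inv k).isHermitian
    rw [mulVec_smul, smul_dotProduct, dotProduct_smul, dotProduct_comm (J *ᵥ θ₀), dotProduct_mulVec,
      ← mulVec_transpose, hsymm, mulVec_mulVec, mulVec_mulVec, dotProduct_comm, hJdef, ← pow_succ,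
      ← pow_add, smul_eq_mul, smul_eq_mul]
    ring_nf
  rw [hvariance] at hclt
  refine tendstoInDistribution_of_tendstoInMeasure_sub _ _ hclt ?_ fun N =>
    (((hηm N).sub_const _).const_mul _).aemeasurable
  refine (tendstoInMeasure_iff_probFilter (c := (0 : ℝ))).2 ?_
  have hsum := (h.tendsto_sqrt_mul_sub_ridgeTarget hn hσ hθ hη).add
    (h.tendsto_sqrt_mul_ridgeTarget_sub (θ₀ := θ₀) hn hrate)
  rw [add_zero] at hsum
  refine hsum.congr fun x => ?_
  simp only [Pi.sub_apply, sampleGram]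
  ring

end IsRegressionModel

end Normality

section LimitCosts

variable {n : ℕ} {σ η : ℝ} {f : ℝ → ℝ} {H : Set ℝ} {θ₀ : Fin n → ℝ}
  {Sig : Matrix (Fin n) (Fin n) ℝ}

/-- `x` is positive and a local minimizer of `f`; the ridge kernel is positive definite at positive
hyper-parameters only. -/
def IsPosLocalMin (f : ℝ → ℝ) (x : ℝ) : Prop := 0 < x ∧ IsLocalMin f x

lemma IsArgmin.isPosLocalMin (h : IsArgmin f H η) (hH : IsOpen H) (hpos : ∀ x ∈ H, 0 < x) :
    IsPosLocalMin f η :=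
  ⟨hpos η h.1, h.2.isLocalMin (hH.mem_nhds h.1)⟩

lemma eventually_isPosLocalMin_of_isArgmin {Ω : Type*} [MeasurableSpace Ω] {μ : Measure Ω}
    {F : ℕ × Ω → ℝ → ℝ} {x : ℕ → Ω → ℝ} (hH : IsOpen H) (hpos : ∀ x ∈ H, 0 < x)
    (h : Tendsto (fun N => μ {ω | ¬ IsArgmin (F (N, ω)) H (x N ω)}) atTop (𝓝 0)) :
    ∀ᶠ p in probFilter μ, IsPosLocalMin (F p) (x p.1 p.2) :=
  Eventually.mono (eventually_probFilter (p := fun p => IsArgmin (F p) H (x p.1 p.2)).2 h)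
    fun _ hp => hp.isPosLocalMin hH hpos

lemma IsPosLocalMin.hasDerivAt_eq_zero {g : ℝ → ℝ} {g' : ℝ} (h : IsPosLocalMin f η)
    (hfg : ∀ x, 0 < x → f x = g x) (hg : HasDerivAt g g' η) : g' = 0 :=
  (h.2.congr ((lt_mem_nhds h.1).mono hfg)).hasDerivAt_eq_zero hg

lemma inv_ridgeKernel (hη : η ≠ 0) : (ridgeKernel n η)⁻¹ = η⁻¹ • 1 := by
  refine Matrix.inv_eq_right_inv ?_
  rw [ridgeKernel, Matrix.smul_mul, Matrix.one_mul, smul_smul, mul_inv_cancel₀ hη, one_smul]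

lemma limitEB_ridgeKernel (θ₀ : Fin n → ℝ) (hη : η ≠ 0) :
    limitEB θ₀ (ridgeKernel n η) = η⁻¹ * (θ₀ ⬝ᵥ θ₀) + n * Real.log η := by
  rw [limitEB, inv_ridgeKernel hη, smul_mulVec, one_mulVec, dotProduct_smul, smul_eq_mul,
    ridgeKernel, det_smul, det_one, mul_one, Fintype.card_fin, Real.log_pow]

lemma limitSy_ridgeKernel (σ : ℝ) (Sig : Matrix (Fin n) (Fin n) ℝ) (θ₀ : Fin n → ℝ)
    (hη : η ≠ 0) :
    limitSy σ Sig θ₀ (ridgeKernel n η) =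
      (η⁻¹) ^ 2 * (σ ^ 4 * (θ₀ ⬝ᵥ (Sig⁻¹ *ᵥ θ₀))) - η⁻¹ * (2 * σ ^ 4 * Sig⁻¹.trace) := by
  rw [limitSy, inv_ridgeKernel hη, transpose_smul, transpose_one]
  simp only [Matrix.smul_mul, Matrix.mul_smul, Matrix.one_mul, Matrix.mul_one, smul_mulVec,
    dotProduct_smul, trace_smul, smul_eq_mul]
  ring

lemma ridgeTarget_eq_of_isPosLocalMin_limitEB (hn : 0 < n)
    (h : IsPosLocalMin (fun x => limitEB θ₀ (ridgeKernel n x)) η) : ridgeTarget 1 θ₀ = η := by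
  have hη := h.1.ne'
  have hderiv := h.hasDerivAt_eq_zero (fun x hx => limitEB_ridgeKernel θ₀ hx.ne')
    (((hasDerivAt_inv hη).mul_const _).add ((Real.hasDerivAt_log hη).const_mul _))
  rw [ridgeTarget, one_mulVec, trace_one, Fintype.card_fin, div_eq_iff (by positivity)]
  field_simp at hderiv
  linarith

lemma ridgeTarget_eq_of_isPosLocalMin_limitSy (hσ : σ ≠ 0) (hSig : Sig⁻¹.trace ≠ 0)
    (h : IsPosLocalMin (fun x => limitSy σ Sig θ₀ (ridgeKernel n x)) η) :
    ridgeTarget Sig⁻¹ θ₀ = η := by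
  have hη := h.1.ne'
  have hderiv := h.hasDerivAt_eq_zero (fun x hx => limitSy_ridgeKernel σ Sig θ₀ hx.ne')
    ((((hasDerivAt_inv hη).pow 2).mul_const _).sub ((hasDerivAt_inv hη).mul_const _))
  rw [ridgeTarget, div_eq_iff hSig]
  simp only [Nat.add_one_sub_one, pow_one, Nat.cast_ofNat] at hderiv
  field_simp at hderiv
  have hfactor := (mul_eq_zero.1 (hderiv.trans (mul_zero _))).resolve_left (by positivity)
  linarith

lemma ne_zero_of_ridgeTarget_ne_zero {J : Matrix (Fin n) (Fin n) ℝ}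
    (h : ridgeTarget J θ₀ ≠ 0) : θ₀ ≠ 0 := by
  rintro rfl
  simp [ridgeTarget] at h

end LimitCosts

section Estimators

variable {n : ℕ} {Ω : Type*} [MeasurableSpace Ω] {μ : Measure Ω} {σ : ℝ}
  {φ : ℕ → Ω → Fin n → ℝ} {v : ℕ → Ω → ℝ} {Sig : Matrix (Fin n) (Fin n) ℝ} {θ₀ : Fin n → ℝ}

lemma abs_apply_le_frobNorm (A : Matrix (Fin n) (Fin n) ℝ) (i j : Fin n) :
    |A i j| ≤ frobNorm A := by
  refine Real.abs_le_sqrt ?_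
  exact (Finset.single_le_sum (f := fun j => A i j ^ 2) (fun _ _ => sq_nonneg _)
    (Finset.mem_univ j)).trans (Finset.single_le_sum (f := fun i => ∑ j, A i j ^ 2)
      (fun _ _ => Finset.sum_nonneg fun _ _ => sq_nonneg _) (Finset.mem_univ i))

lemma tendsto_sqrt_mul_of_isBigOInProb {ξ : ℕ → Ω → ℝ} {δ : ℕ → ℝ} (hδ : ∀ N, 0 < δ N)
    (hξ : IsBigOInProb μ ξ δ) (ho : δ =o[atTop] fun N : ℕ => 1 / √N) :
    Tendsto (fun x : ℕ × Ω => √x.1 * ξ x.1 x.2) (probFilter μ) (𝓝 0) := by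
  rw [Metric.tendsto_nhds]
  intro ε hε
  rw [eventually_probFilter, ENNReal.tendsto_nhds_zero]
  intro ε' hε'
  obtain ⟨r, hr0, hr⟩ := ENNReal.lt_iff_exists_nnreal_btwn.1 hε'
  obtain ⟨L, hL, hbound⟩ := hξ r (NNReal.coe_pos.2 (ENNReal.coe_pos.1 hr0))
  rw [ENNReal.ofReal_coe_nnreal] at hbound
  filter_upwards [ho.bound (by positivity : 0 < ε / (2 * L)), eventually_ge_atTop 1] with N hN hN1
  refine (measure_mono fun ω hω => ?_).trans ((hbound N hN1).le.trans hr.le)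
  have hsqrt : 0 < √(N : ℝ) := Real.sqrt_pos.2 (Nat.cast_pos.2 hN1)
  rw [Real.norm_of_nonneg (hδ N).le, Real.norm_of_nonneg (by positivity)] at hN
  by_contra hle
  rw [Set.mem_ofPred_eq, not_lt, abs_div, abs_of_pos (hδ N), div_le_iff₀ (hδ N)] at hle
  refine hω ?_
  rw [dist_zero_right, norm_mul, Real.norm_of_nonneg hsqrt.le, Real.norm_eq_abs]
  calc √(N : ℝ) * |ξ N ω| ≤ √(N : ℝ) * (L * (ε / (2 * L) * (1 / √(N : ℝ)))) := by
        gcongr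
        exact hle.trans (by gcongr)
    _ = ε / 2 := by field_simp
    _ < ε := half_lt_self hε

lemma tendsto_sqrt_smul_sub_of_isBigOInProb {δ : ℕ → ℝ} (hδ : ∀ N, 0 < δ N)
    (hξ : IsBigOInProb μ (fun N ω => frobNorm (sampleGram φ (N, ω) - Sig)) δ)
    (ho : δ =o[atTop] fun N : ℕ => 1 / √N) :
    Tendsto (fun x => √x.1 • (sampleGram φ x - Sig)) (probFilter μ) (𝓝 0) := by
  refine tendsto_pi_nhds.2 fun i => tendsto_pi_nhds.2 fun j =>
    squeeze_zero_norm (fun x => ?_) (tendsto_sqrt_mul_of_isBigOInProb hδ hξ ho)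
  rw [Matrix.smul_apply, norm_smul, Real.norm_of_nonneg (Real.sqrt_nonneg _)]
  exact mul_le_mul_of_nonneg_left (abs_apply_le_frobNorm _ i j) (Real.sqrt_nonneg _)

namespace IsRegressionModel

/-- Resolvent identity: `G⁻¹ - Sig⁻¹ = G⁻¹ (Sig - G) Sig⁻¹`. -/
lemma tendsto_sqrt_smul_inv_sub_inv (h : IsRegressionModel μ σ φ v Sig)
    (hrate : Tendsto (fun x => √x.1 • (sampleGram φ x - Sig)) (probFilter μ) (𝓝 0)) :
    Tendsto (fun x => √x.1 • ((sampleGram φ x)⁻¹ - Sig⁻¹)) (probFilter μ) (𝓝 0) := by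
  have hlim := ((h.tendsto_inv_gram.mul hrate).mul_const Sig⁻¹).neg
  rw [Matrix.mul_zero, Matrix.zero_mul, neg_zero] at hlim
  refine hlim.congr' (h.eventually_isUnit_det.mono fun x hx => ?_)
  rw [Matrix.mul_smul, Matrix.smul_mul, ← smul_neg, Matrix.mul_sub, Matrix.sub_mul,
    Matrix.nonsing_inv_mul _ hx, Matrix.one_mul, Matrix.mul_assoc,
    Matrix.mul_nonsing_inv _ h.posDef.det_pos.ne'.isUnit, Matrix.mul_one, neg_sub]

variable [IsProbabilityMeasure μ]

theorem tendstoInDistribution_empiricalBayes (h : IsRegressionModel μ σ φ v Sig) (hn : 0 < n)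
    (hσ : σ ≠ 0) {ηb : ℝ} {η : ℕ → Ω → ℝ}
    (hb : IsPosLocalMin (fun y => limitEB θ₀ (ridgeKernel n y)) ηb)
    (hηm : ∀ N, Measurable (η N))
    (hη : ∀ᶠ x in probFilter μ, IsPosLocalMin (fun y => costEB σ (regMatrix (fun t => φ t x.2) x.1)
      (outputVec (fun t => φ t x.2) (fun t => v t x.2) θ₀ x.1) (ridgeKernel n y)) (η x.1 x.2)) :
    TendstoInDistribution (fun (N : ℕ) ω => √N * (η N ω - ηb)) atTop (id : ℝ → ℝ) (fun _ => μ)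
      (gaussianReal 0 (Real.toNNReal (asympVarEB σ Sig θ₀))) := by
  have htarget := ridgeTarget_eq_of_isPosLocalMin_limitEB hn hb
  have hnormal := h.tendstoInDistribution_of_isStationary (k := 0) hn hσ
    (ne_zero_of_ridgeTarget_ne_zero (htarget.trans_ne hb.1.ne')) hηm
    (hη.mono fun x hx => isStationary_zero_of_isLocalMin_costEB hσ hx.1 hx.2)
    (by simp only [pow_zero, sub_self, smul_zero, tendsto_const_nhds])
  simpa only [asympVarEB, pow_zero, htarget, trace_one, Fintype.card_fin, mul_zero, zero_add,
    pow_one] using hnormal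

theorem tendstoInDistribution_sure (h : IsRegressionModel μ σ φ v Sig) (hn : 0 < n)
    (hσ : σ ≠ 0) {ηy : ℝ} {η : ℕ → Ω → ℝ}
    (hrate : Tendsto (fun x => √x.1 • (sampleGram φ x - Sig)) (probFilter μ) (𝓝 0))
    (hy : IsPosLocalMin (fun y => limitSy σ Sig θ₀ (ridgeKernel n y)) ηy)
    (hηm : ∀ N, Measurable (η N))
    (hη : ∀ᶠ x in probFilter μ, IsPosLocalMin (fun y => costSy σ (regMatrix (fun t => φ t x.2) x.1)
      (outputVec (fun t => φ t x.2) (fun t => v t x.2) θ₀ x.1) (ridgeKernel n y)) (η x.1 x.2)) :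
    TendstoInDistribution (fun (N : ℕ) ω => √N * (η N ω - ηy)) atTop (id : ℝ → ℝ) (fun _ => μ)
      (gaussianReal 0 (Real.toNNReal (asympVarSy σ Sig θ₀))) := by
  have htrace : 0 < Sig⁻¹.trace := by simpa only [pow_one] using trace_pow_pos hn h.posDef.inv 1
  have htarget := ridgeTarget_eq_of_isPosLocalMin_limitSy hσ htrace.ne' hy
  have hnormal := h.tendstoInDistribution_of_isStationary (k := 1) hn hσ
    (ne_zero_of_ridgeTarget_ne_zero (htarget.trans_ne hy.1.ne')) hηm
    (hη.mono fun x hx => isStationary_one_of_isLocalMin_costSy hσ hx.1 hx.2)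
    (by simpa only [pow_one] using h.tendsto_sqrt_smul_inv_sub_inv hrate)
  simpa only [asympVarSy, pow_one, htarget] using hnormal

end IsRegressionModel

end Estimators

section VarianceRatio

variable {n : ℕ} {R S : Matrix (Fin n) (Fin n) ℝ} {u : Fin n → ℝ}

lemma mul_vecMulVec_self (hRu : R *ᵥ u = u) : R * vecMulVec u u = vecMulVec u u := by
  rw [mul_vecMulVec, hRu]

lemma vecMulVec_self_mul (hR : R.IsHermitian) (hRu : R *ᵥ u = u) :
    vecMulVec u u * R = vecMulVec u u := by
  rw [vecMulVec_mul, ← mulVec_transpose, ← conjTranspose_eq_transpose_of_trivial, hR, hRu]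

lemma isIdempotentElem_vecMulVec_self (hu : u ⬝ᵥ u = 1) : IsIdempotentElem (vecMulVec u u) := by
  rw [IsIdempotentElem, vecMulVec_mul_vecMulVec, hu, one_smul]

/-- The difference is the compression of `R` to the orthogonal complement of `u`. -/
lemma posSemidef_sub_vecMulVec (hR : R.PosSemidef) (hRu : R *ᵥ u = u) (hu : u ⬝ᵥ u = 1) :
    (R - vecMulVec u u).PosSemidef := by
  have hcompress := hR.mul_mul_conjTranspose_same (1 - vecMulVec u u)
  rwa [conjTranspose_eq_transpose_of_trivial, transpose_sub, transpose_one, transpose_vecMulVec,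
    Matrix.sub_mul, Matrix.one_mul, vecMulVec_self_mul hR.isHermitian hRu, Matrix.mul_sub,
    Matrix.mul_one, Matrix.sub_mul, mul_vecMulVec_self hRu, (isIdempotentElem_vecMulVec_self hu).eq,
    sub_self, sub_zero] at hcompress

lemma pow_three_sub_self_eq (hR : R.IsHermitian) (hRu : R *ᵥ u = u) (hu : u ⬝ᵥ u = 1) :
    R ^ 3 - R = (R - vecMulVec u u) ^ 3 - (R - vecMulVec u u) := by
  have hRP := mul_vecMulVec_self hRu
  have hPR := vecMulVec_self_mul hR hRu
  have hPP := (isIdempotentElem_vecMulVec_self hu).eq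
  simp only [pow_succ, pow_zero, Matrix.one_mul, Matrix.mul_sub, Matrix.sub_mul, Matrix.mul_assoc,
    hRP, hPR, hPP]
  abel

lemma sq_dotProduct_le_of_mulVec_eq_self (hR : R.PosSemidef) (hRu : R *ᵥ u = u)
    (hu : u ⬝ᵥ u = 1) (θ : Fin n → ℝ) : (u ⬝ᵥ θ) ^ 2 ≤ θ ⬝ᵥ (R *ᵥ θ) := by
  have hnonneg := (posSemidef_sub_vecMulVec hR hRu hu).dotProduct_mulVec_nonneg θ
  rw [star_trivial, sub_mulVec, dotProduct_sub, sub_nonneg, vecMulVec_mulVec, op_smul_eq_smul,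
    dotProduct_smul, dotProduct_comm θ u, smul_eq_mul, ← sq] at hnonneg
  exact hnonneg

lemma exists_equiv_sortedEig_eq (hS : S.IsHermitian) :
    ∃ e : Fin n ≃ Fin n, ∀ i, sortedEig hS i = hS.eigenvalues (e i) :=
  ⟨(finCongr (Fintype.card_fin n).symm).trans (Fintype.equivOfCardEq (Fintype.card_fin _)),
    fun i => by simp [sortedEig, IsHermitian.eigenvalues]⟩

lemma sortedEig_pos (hS : S.PosDef) (i : Fin n) : 0 < sortedEig hS.isHermitian i := by
  obtain ⟨e, he⟩ := exists_equiv_sortedEig_eq hS.isHermitian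
  exact (hS.eigenvalues_pos (e i)).trans_eq (he i).symm

lemma trace_inv_eq_sum_inv_sortedEig (hS : S.PosDef) :
    S⁻¹.trace = ∑ i, (sortedEig hS.isHermitian i)⁻¹ := by
  obtain ⟨e, he⟩ := exists_equiv_sortedEig_eq hS.isHermitian
  simp only [he]
  rw [e.sum_comp fun i => (hS.isHermitian.eigenvalues i)⁻¹]
  conv_lhs => rw [eq_spectralHom_eigenvalues hS.isHermitian]
  rw [inv_spectralHom fun i => (hS.eigenvalues_pos i).ne', trace_spectralHom]
  rfl

lemma smul_inv_mulVec_eq {lam : ℝ} (hS : IsUnit S.det) (hSu : S *ᵥ u = lam • u) :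
    (lam • S⁻¹) *ᵥ u = u := by
  rw [smul_mulVec, ← mulVec_smul, ← hSu, mulVec_mulVec, Matrix.nonsing_inv_mul _ hS, one_mulVec]

lemma asympVarEB_div_asympVarSy {σ lam : ℝ} (hσ : σ ≠ 0) (hlam : lam ≠ 0)
    (S : Matrix (Fin n) (Fin n) ℝ) (θ : Fin n → ℝ) :
    asympVarEB σ S θ / asympVarSy σ S θ = (lam * S⁻¹.trace) ^ 2 *
      ((θ ⬝ᵥ ((lam • S⁻¹) ^ 3 *ᵥ θ)) / (θ ⬝ᵥ ((lam • S⁻¹) *ᵥ θ)))⁻¹ / (n : ℝ) ^ 2 := by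
  rw [asympVarEB, asympVarSy, smul_pow, smul_mulVec, smul_mulVec, dotProduct_smul, dotProduct_smul,
    smul_eq_mul, smul_eq_mul, inv_div]
  field_simp

variable {α : Type*} {l : Filter α}

lemma tendsto_zero_of_tendsto_trace {D : α → Matrix (Fin n) (Fin n) ℝ}
    (hD : ∀ k, (D k).PosSemidef) (htrace : Tendsto (fun k => (D k).trace) l (𝓝 0)) :
    Tendsto D l (𝓝 0) :=
  tendsto_pi_nhds.2 fun i => tendsto_pi_nhds.2 fun j =>
    squeeze_zero_norm (fun k => abs_apply_le_trace (hD k) i j) htrace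

lemma tendsto_pow_three_sub_self {R : α → Matrix (Fin n) (Fin n) ℝ} {u : α → Fin n → ℝ}
    (hR : ∀ k, (R k).PosSemidef) (hRu : ∀ k, R k *ᵥ u k = u k) (hu : ∀ k, u k ⬝ᵥ u k = 1)
    (htrace : Tendsto (fun k => (R k).trace) l (𝓝 1)) :
    Tendsto (fun k => R k ^ 3 - R k) l (𝓝 0) := by
  have hD := tendsto_zero_of_tendsto_trace
    (fun k => posSemidef_sub_vecMulVec (hR k) (hRu k) (hu k))
    (by simpa only [trace_sub, trace_vecMulVec, hu, sub_self] using htrace.sub_const 1)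
  simpa only [pow_three_sub_self_eq (hR _).isHermitian (hRu _) (hu _), ne_eq, OfNat.ofNat_ne_zero,
    not_false_eq_true, zero_pow, sub_self] using (hD.pow 3).sub hD

lemma tendsto_div_one_of_tendsto_sub {a b : α → ℝ} {c : ℝ} (hc : 0 < c) (ha : ∀ k, c ≤ a k)
    (hab : Tendsto (fun k => b k - a k) l (𝓝 0)) : Tendsto (fun k => b k / a k) l (𝓝 1) := by
  rw [tendsto_iff_norm_sub_tendsto_zero]
  refine squeeze_zero (fun _ => norm_nonneg _) (fun k => ?_)
    (by simpa only [norm_zero, zero_div] using hab.norm.div_const c)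
  have hak := hc.trans_le (ha k)
  rw [div_sub_one hak.ne', norm_div, Real.norm_of_nonneg hak.le]
  exact div_le_div_of_nonneg_left (norm_nonneg _) hc (ha k)

variable {S : α → Matrix (Fin n) (Fin n) ℝ} {u : α → Fin n → ℝ} {θ₀ : Fin n → ℝ} {σ c : ℝ}
  {lam : α → ℝ}

theorem tendsto_asympVarEB_div_asympVarSy (hσ : σ ≠ 0) (hS : ∀ k, (S k).PosDef)
    (hlam : ∀ k, 0 < lam k) (hlim : Tendsto (fun k => lam k * (S k)⁻¹.trace) l (𝓝 1))
    (hu : ∀ k, u k ⬝ᵥ u k = 1) (hSu : ∀ k, S k *ᵥ u k = lam k • u k)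
    (hc : 0 < c) (hcu : ∀ k, c ≤ |u k ⬝ᵥ θ₀|) :
    Tendsto (fun k => asympVarEB σ (S k) θ₀ / asympVarSy σ (S k) θ₀) l (𝓝 (1 / (n : ℝ) ^ 2)) := by
  set R := fun k => lam k • (S k)⁻¹
  have hR : ∀ k, (R k).PosSemidef := fun k => (hS k).inv.posSemidef.smul (hlam k).le
  have hRu : ∀ k, R k *ᵥ u k = u k := fun k =>
    smul_inv_mulVec_eq (hS k).det_pos.ne'.isUnit (hSu k)
  have hcube := tendsto_pow_three_sub_self hR hRu hu
    (by simpa only [R, trace_smul, smul_eq_mul] using hlim)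
  have hθ : Tendsto (fun _ : α => θ₀) l (𝓝 θ₀) := tendsto_const_nhds
  have hform := tendsto_dotProduct hθ (tendsto_mulVec hcube hθ)
  simp only [sub_mulVec, dotProduct_sub, zero_mulVec, dotProduct_zero] at hform
  have hlower : ∀ k, c ^ 2 ≤ θ₀ ⬝ᵥ (R k *ᵥ θ₀) := fun k =>
    (sq_le_sq.2 (by rw [abs_of_pos hc]; exact hcu k)).trans
      (sq_dotProduct_le_of_mulVec_eq_self (hR k) (hRu k) (hu k) θ₀)
  have hquot := (tendsto_div_one_of_tendsto_sub (by positivity) hlower hform).inv₀ one_ne_zero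
  have hratio := ((hlim.pow 2).mul hquot).div_const ((n : ℝ) ^ 2)
  rw [one_pow, inv_one, mul_one] at hratio
  exact hratio.congr fun k => (asympVarEB_div_asympVarSy hσ (hlam k).ne' (S k) θ₀).symm

lemma tendsto_sortedEig_mul_trace_inv (hS : ∀ k, (S k).PosDef) {j : Fin n}
    (hspec : ∀ i, i ≠ j → Tendsto (fun k => sortedEig (hS k).isHermitian i /
      sortedEig (hS k).isHermitian j) l atTop) :
    Tendsto (fun k => sortedEig (hS k).isHermitian j * (S k)⁻¹.trace) l (𝓝 1) := by
  have hterm : ∀ i, Tendsto (fun k => sortedEig (hS k).isHermitian j *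
      (sortedEig (hS k).isHermitian i)⁻¹) l (𝓝 (if i = j then 1 else 0)) := fun i => by
    split_ifs with hij
    · subst hij
      simp only [mul_inv_cancel₀ (sortedEig_pos (hS _) i).ne', tendsto_const_nhds]
    · exact (hspec i hij).inv_tendsto_atTop.congr fun k =>
        (inv_div _ _).trans (div_eq_mul_inv _ _)
  have hsum := tendsto_finsetSum Finset.univ fun i _ => hterm i
  simpa only [trace_inv_eq_sum_inv_sortedEig (hS _), Finset.mul_sum, Finset.sum_ite_eq',
    Finset.mem_univ, if_true] using hsum

lemma tendsto_sortedEig_div_atTop (hS : ∀ k, (S k).PosDef) {i j : Fin n} {m : ℝ}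
    (hm : ∀ k, sortedEig (hS k).isHermitian i = m) (hm0 : 0 < m)
    (hlim : Tendsto (fun k => sortedEig (hS k).isHermitian j) l (𝓝 0)) :
    Tendsto (fun k => sortedEig (hS k).isHermitian i / sortedEig (hS k).isHermitian j) l
      atTop := by
  have hpos := tendsto_nhdsWithin_iff.2 ⟨hlim, .of_forall fun k => sortedEig_pos (hS k) j⟩
  simpa only [hm, div_eq_mul_inv, Function.comp_def] using
    (tendsto_inv_nhdsGT_zero.comp hpos).const_mul_atTop hm0

end VarianceRatio

end RidgeAsymptotics

open RidgeAsymptotics in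
theorem corollary1_general {Ω : Type*} [MeasurableSpace Ω] {μ : Measure Ω}
    [IsProbabilityMeasure μ] {n : ℕ} (hn : 0 < n) {σ : ℝ} (hσ : σ ≠ 0) (θ₀ : Fin n → ℝ)
    {φ : ℕ → Ω → Fin n → ℝ} {v : ℕ → Ω → ℝ} {Sig : Matrix (Fin n) (Fin n) ℝ}
    (h : IsRegressionModel μ σ φ v Sig) :
    (∀ (ηb : ℝ) (ηEB : ℕ → Ω → ℝ),
      IsPosLocalMin (fun η => limitEB θ₀ (ridgeKernel n η)) ηb →
      (∀ N, Measurable (ηEB N)) →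
      (∀ᶠ x in probFilter μ, IsPosLocalMin (fun η => costEB σ (regMatrix (fun t => φ t x.2) x.1)
        (outputVec (fun t => φ t x.2) (fun t => v t x.2) θ₀ x.1) (ridgeKernel n η))
        (ηEB x.1 x.2)) →
      TendstoInDistribution (fun (N : ℕ) ω => √N * (ηEB N ω - ηb)) atTop (id : ℝ → ℝ)
        (fun _ => μ) (gaussianReal 0 (Real.toNNReal (asympVarEB σ Sig θ₀)))) ∧
    (∀ (ηy : ℝ) (ηSy : ℕ → Ω → ℝ),
      Tendsto (fun x => √x.1 • (sampleGram φ x - Sig)) (probFilter μ) (𝓝 0) →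
      IsPosLocalMin (fun η => limitSy σ Sig θ₀ (ridgeKernel n η)) ηy →
      (∀ N, Measurable (ηSy N)) →
      (∀ᶠ x in probFilter μ, IsPosLocalMin (fun η => costSy σ (regMatrix (fun t => φ t x.2) x.1)
        (outputVec (fun t => φ t x.2) (fun t => v t x.2) θ₀ x.1) (ridgeKernel n η))
        (ηSy x.1 x.2)) →
      TendstoInDistribution (fun (N : ℕ) ω => √N * (ηSy N ω - ηy)) atTop (id : ℝ → ℝ)
        (fun _ => μ) (gaussianReal 0 (Real.toNNReal (asympVarSy σ Sig θ₀)))) ∧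
    (∀ (S : ℕ → Matrix (Fin n) (Fin n) ℝ) (hS : ∀ k, (S k).PosDef) (j : Fin n)
      (u : ℕ → Fin n → ℝ) (c : ℝ),
      (∀ i, i ≠ j → Tendsto (fun k => sortedEig (hS k).isHermitian i /
        sortedEig (hS k).isHermitian j) atTop atTop) →
      (∀ k, u k ⬝ᵥ u k = 1) →
      (∀ k, S k *ᵥ u k = sortedEig (hS k).isHermitian j • u k) →
      0 < c → (∀ k, c ≤ |u k ⬝ᵥ θ₀|) →
      Tendsto (fun k => asympVarEB σ (S k) θ₀ / asympVarSy σ (S k) θ₀) atTop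
        (𝓝 (1 / (n : ℝ) ^ 2))) :=
  ⟨fun _ _ hb hηm hη => h.tendstoInDistribution_empiricalBayes hn hσ hb hηm hη,
    fun _ _ hrate hy hηm hη => h.tendstoInDistribution_sure hn hσ hrate hy hηm hη,
    fun _ hS j _ _ hspec hu hSu hc hcu => tendsto_asympVarEB_div_asympVarSy hσ hS
      (fun k => sortedEig_pos (hS k) j) (tendsto_sortedEig_mul_trace_inv hS hspec) hu hSu hc hcu⟩

theorem corollary1 {Ω : Type*} [MeasurableSpace Ω] (μ : Measure Ω) [IsProbabilityMeasure μ]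
    (n : ℕ) (hn : 2 ≤ n) (σ : ℝ) (hσ : 0 < σ) (θ₀ : Fin n → ℝ)
    -- regressors and noise
    (φ : ℕ → Ω → Fin n → ℝ) (v : ℕ → Ω → ℝ)
    (hφ_meas : ∀ t, Measurable (φ t)) (hv_meas : ∀ t, Measurable (v t))
    (hv_law : ∀ t, μ.map (v t) = gaussianReal 0 (Real.toNNReal (σ ^ 2)))
    (hv_indep : iIndepFun v μ)
    (hφv : IndepFun (fun ω t => φ t ω) (fun ω t => v t ω) μ)
    -- almost sure convergence of `ΦᵀΦ / N` to a positive definite matrix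
    (Sig : Matrix (Fin n) (Fin n) ℝ) (hSig : Sig.PosDef)
    (hconv : ∀ᵐ ω ∂μ, Tendsto
      (fun N : ℕ => (N : ℝ)⁻¹ • ((RidgeAsymptotics.regMatrix (fun t => φ t ω) N)ᵀ *
        RidgeAsymptotics.regMatrix (fun t => φ t ω) N)) atTop (𝓝 Sig))
    -- the hyper-parameter set; `η I_n` is positive definite on it
    (H : Set ℝ) (hH_open : IsOpen H) (hH_pos : ∀ η ∈ H, 0 < η) :
    -- asymptotic normality of the empirical Bayes hyper-parameter estimator
    (∀ (ηb : ℝ) (ηEB : ℕ → Ω → ℝ),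
      RidgeAsymptotics.IsArgmin
        (fun η => RidgeAsymptotics.limitEB θ₀ (RidgeAsymptotics.ridgeKernel n η)) H ηb →
      (∀ N, Measurable (ηEB N)) →
      Tendsto (fun N : ℕ => μ {ω | ¬ RidgeAsymptotics.IsArgmin
        (fun η => RidgeAsymptotics.costEB σ (RidgeAsymptotics.regMatrix (fun t => φ t ω) N)
          (RidgeAsymptotics.outputVec (fun t => φ t ω) (fun t => v t ω) θ₀ N)
          (RidgeAsymptotics.ridgeKernel n η)) H (ηEB N ω)}) atTop (𝓝 0) →
      TendstoInDistribution (fun (N : ℕ) ω => Real.sqrt N * (ηEB N ω - ηb)) atTop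
        (id : ℝ → ℝ) (fun _ => μ)
        (gaussianReal 0 (Real.toNNReal (RidgeAsymptotics.asympVarEB σ Sig θ₀)))) ∧
    -- asymptotic normality of the `SURE_y` hyper-parameter estimator
    (∀ (ηy : ℝ) (ηSy : ℕ → Ω → ℝ) (δ : ℕ → ℝ),
      (∀ N, 0 < δ N) →
      RidgeAsymptotics.IsBigOInProb μ
        (fun N ω => RidgeAsymptotics.frobNorm
          ((N : ℝ)⁻¹ • ((RidgeAsymptotics.regMatrix (fun t => φ t ω) N)ᵀ *
            RidgeAsymptotics.regMatrix (fun t => φ t ω) N) - Sig)) δ →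
      δ =o[atTop] (fun N : ℕ => 1 / Real.sqrt N) →
      RidgeAsymptotics.IsArgmin
        (fun η => RidgeAsymptotics.limitSy σ Sig θ₀ (RidgeAsymptotics.ridgeKernel n η)) H ηy →
      (∀ N, Measurable (ηSy N)) →
      Tendsto (fun N : ℕ => μ {ω | ¬ RidgeAsymptotics.IsArgmin
        (fun η => RidgeAsymptotics.costSy σ (RidgeAsymptotics.regMatrix (fun t => φ t ω) N)
          (RidgeAsymptotics.outputVec (fun t => φ t ω) (fun t => v t ω) θ₀ N)
          (RidgeAsymptotics.ridgeKernel n η)) H (ηSy N ω)}) atTop (𝓝 0) →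
      TendstoInDistribution (fun (N : ℕ) ω => Real.sqrt N * (ηSy N ω - ηy)) atTop
        (id : ℝ → ℝ) (fun _ => μ)
        (gaussianReal 0 (Real.toNNReal (RidgeAsymptotics.asympVarSy σ Sig θ₀)))) ∧
    -- the ratio of the two asymptotic variances as `λ_n → 0` with `λ_1, …, λ_{n-1}` fixed
    (∀ (S : ℕ → Matrix (Fin n) (Fin n) ℝ) (hS : ∀ k, (S k).PosDef)
      (u : ℕ → Fin n → ℝ) (c : ℝ),
      (∀ k, ∀ i : Fin n, (i : ℕ) < n - 1 →
        RidgeAsymptotics.sortedEig (hS k).isHermitian i =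
          RidgeAsymptotics.sortedEig (hS 0).isHermitian i) →
      Tendsto (fun k => RidgeAsymptotics.sortedEig (hS k).isHermitian ⟨n - 1, by omega⟩)
        atTop (𝓝 0) →
      -- `u k` is a unit eigenvector for `λ_n`, and its inner product with `θ₀` stays away from `0`
      (∀ k, u k ⬝ᵥ u k = 1) →
      (∀ k, S k *ᵥ u k =
        RidgeAsymptotics.sortedEig (hS k).isHermitian ⟨n - 1, by omega⟩ • u k) →
      0 < c → (∀ k, c ≤ |u k ⬝ᵥ θ₀|) →
      Tendsto (fun k => RidgeAsymptotics.sortedEig (hS k).isHermitian ⟨0, by omega⟩ /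
        RidgeAsymptotics.sortedEig (hS k).isHermitian ⟨n - 1, by omega⟩) atTop atTop ∧
      Tendsto (fun k => RidgeAsymptotics.asympVarEB σ (S k) θ₀ /
        RidgeAsymptotics.asympVarSy σ (S k) θ₀) atTop (𝓝 (1 / (n : ℝ) ^ 2))) := by
  have hmodel := RidgeAsymptotics.IsRegressionModel.of_ae_tendsto ⟨hv_meas, hv_law, hv_indep⟩
    hφ_meas hφv hSig hconv
  obtain ⟨hEB, hSy, hvar⟩ := corollary1_general (by omega : 0 < n) hσ.ne' θ₀ hmodel
  refine ⟨fun ηb ηEB hb hm hmin => ?_, fun ηy ηSy δ hδ hrate ho hy hm hmin => ?_,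
    fun S hS u c hfix hlim hu hSu hc hcu => ?_⟩
  · exact hEB ηb ηEB (hb.isPosLocalMin hH_open hH_pos) hm
      (RidgeAsymptotics.eventually_isPosLocalMin_of_isArgmin hH_open hH_pos hmin)
  · exact hSy ηy ηSy (RidgeAsymptotics.tendsto_sqrt_smul_sub_of_isBigOInProb hδ hrate ho)
      (hy.isPosLocalMin hH_open hH_pos) hm
      (RidgeAsymptotics.eventually_isPosLocalMin_of_isArgmin hH_open hH_pos hmin)
  · have hspec := fun (i : Fin n) (hi : (i : ℕ) < n - 1) =>
      RidgeAsymptotics.tendsto_sortedEig_div_atTop hS (fun k => hfix k i hi)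
        (RidgeAsymptotics.sortedEig_pos (hS 0) i) hlim
    exact ⟨hspec _ (by simp only; omega),
      hvar S hS _ u c (fun i hi => hspec i (by grind)) hu hSu hc hcu⟩
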